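/- Let $\Lambda=\{\lambda_j\}_{j\ge 0}$ be an increasing sequence of positive real numbers which is quasi-lacunary: there are integers $0=m_0<m_1<m_2<\cdots$, an integer $N\ge 1$ and a real $q>1$ such that the consecutive blocks $E_k=\{\lambda_j : m_k\le j<m_{k+1}\}$ satisfy $\#E_k\le N$ for all $k$, and $\max E_{k+1}/\max E_{k}>q$ for all large $k$. Let $M_\Lambda$ be the space of all finite linear combinations (with real or with complex coefficients) of the functions $t\mapsto t^{\lambda_j}$ on $[0,1]$, and let $F_k=\operatorname{Span}\{t^{\lambda}:\lambda\in E_k\}$. For $\alpha>0$ let $\mathrm{d}\nu_{\alpha-1}=(1-x)^{\alpha-1}\,\mathrm{d}x$ on $[0,1]$. Let $\beta\ge 1$, $p\ge\beta$, and let $\mu$ be a positive Borel measure on $[0,1]$. Assume that the inclusion $\imath_\mu: f\mapsto f$ is of restricted weak type $p$, uniformly on blocks: there is a constant $C_p>0$ such that for all $k\ge 0$, all $f\in F_k$ and all $y>0$, $$\mu(|f|>y)\le C_p^{\,p}\,y^{-p}\,\|f\|^{p}_{L^{p/\beta}(\mathrm{d}\nu_{\alpha-1})}.$$ Then for every $r>p$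 the inclusion $\imath_\mu$ is of strong type $r$: there is a constant $C_r>0$ such that for all $f\in M_\Lambda$, $$\|f\|_{L^r(\mathrm{d}\mu)}\le C_r\,\|f\|_{L^{r/\beta}(\mathrm{d}\nu_{\alpha-1})},$$ that is, $M_\Lambda$ with the norm of $L^{r/\beta}(\mathrm{d}\nu_{\alpha-1})$ embeds continuously in $L^r(\mathrm{d}\mu)$. -/

import Mathlib

open MeasureTheory Filter
open scoped unitInterval ENNReal

noncomputable section

/-- The monomial `t ↦ t ^ l` on `[0, 1]`, with values in `𝕜` (the real or complex numbers). -/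
def muntzMonomial (𝕜 : Type*) [RCLike 𝕜] (l : ℝ) : I → 𝕜 :=
  fun t => (((t : ℝ) ^ l : ℝ) : 𝕜)

/-- The space `M_Λ` of Müntz polynomials: all finite sums `∑ a_k t ^ (Λ k)` on `[0, 1]`. -/
def muntzSpace (𝕜 : Type*) [RCLike 𝕜] (Λ : ℕ → ℝ) : Submodule 𝕜 (I → 𝕜) :=
  Submodule.span 𝕜 (Set.range fun k => muntzMonomial 𝕜 (Λ k))

/-- The block of exponents `E_k = {Λ j : n k ≤ j < n (k + 1)}`; its largest element is
`Λ (n (k + 1) - 1)` when the block is nonempty and `Λ` is increasing. -/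
def muntzBlock (Λ : ℕ → ℝ) (n : ℕ → ℕ) (k : ℕ) : Finset ℝ :=
  (Finset.Ico (n k) (n (k + 1))).image Λ

/-- The block space `F_k = Span {t ^ l : l ∈ E_k}`. -/
def muntzBlockSpace (𝕜 : Type*) [RCLike 𝕜] (Λ : ℕ → ℝ) (n : ℕ → ℕ) (k : ℕ) :
    Submodule 𝕜 (I → 𝕜) :=
  Submodule.span 𝕜 (muntzMonomial 𝕜 '' (muntzBlock Λ n k : Set ℝ))

/-- `Λ` is an increasing sequence of positive reals, and it is quasi-lacunary with respect to its
partition into the consecutive blocks `E_k`: the blocks have at most `N` elements, and for `k`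
large the ratio of the largest elements of two consecutive blocks exceeds a fixed `q > 1`. -/
structure IsQuasiLacunary (Λ : ℕ → ℝ) (n : ℕ → ℕ) : Prop where
  pos : ∀ k, 0 < Λ k
  strictMono : StrictMono Λ
  blocks_zero : n 0 = 0
  blocks_strictMono : StrictMono n
  card_le : ∃ N : ℕ, 1 ≤ N ∧ ∀ k, (muntzBlock Λ n k).card ≤ N
  ratio : ∃ q : ℝ, 1 < q ∧ ∀ᶠ k in atTop, q < Λ (n (k + 1) - 1) / Λ (n k - 1)

/-- The measure `dν_{α-1} = (1 - x) ^ (α - 1) dx` on `[0, 1]`, indexed by `α`. -/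
def muntzWeight (α : ℝ) : Measure I :=
  (volume : Measure I).withDensity fun x => ENNReal.ofReal ((1 - (x : ℝ)) ^ (α - 1))

/-- `T`, defined on `M_Λ`, is of strong type `r`:
`‖T f‖_{L^r(μ)} ≤ C ‖f‖_{L^{r/β}(ν_{α-1})}` for all `f` in `M_Λ`. -/
def IsStrongType {𝕜 : Type*} [RCLike 𝕜] {Λ : ℕ → ℝ} (α β : ℝ) (μ : Measure I) (r : ℝ)
    (T : muntzSpace 𝕜 Λ → I → 𝕜) : Prop :=
  ∃ C : ℝ, 0 < C ∧ ∀ f : muntzSpace 𝕜 Λ,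
    eLpNorm (T f) (ENNReal.ofReal r) μ ≤
      ENNReal.ofReal C * eLpNorm (f : I → 𝕜) (ENNReal.ofReal (r / β)) (muntzWeight α)

/-- `T` is of restricted weak type `r`, uniformly on the blocks: with one constant `C` for all `k`,
`μ(|T f| > y) ≤ C ^ r y ^ (-r) ‖f‖_{L^{r/β}(ν_{α-1})} ^ r` for all `f` in `F_k` and `y > 0`. -/
def IsRestrictedWeakType {𝕜 : Type*} [RCLike 𝕜] {Λ : ℕ → ℝ} (n : ℕ → ℕ) (α β : ℝ)
    (μ : Measure I) (r : ℝ) (T : muntzSpace 𝕜 Λ → I → 𝕜) : Prop :=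
  ∃ C : ℝ, 0 < C ∧ ∀ k : ℕ, ∀ f : muntzSpace 𝕜 Λ,
    (f : I → 𝕜) ∈ muntzBlockSpace 𝕜 Λ n k → ∀ y : ℝ, 0 < y →
      μ {t | y < ‖T f t‖} ≤ ENNReal.ofReal (C ^ r * y ^ (-r)) *
        eLpNorm (f : I → 𝕜) (ENNReal.ofReal (r / β)) (muntzWeight α) ^ r

/-- The inclusion `ı_μ : f ↦ f` of `M_Λ` into the functions on `[0, 1]`, which are measured with
`μ`. -/
def muntzInclusion (𝕜 : Type*) [RCLike 𝕜] (Λ : ℕ → ℝ) : muntzSpace 𝕜 Λ →ₗ[𝕜] (I → 𝕜) :=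
  (muntzSpace 𝕜 Λ).subtype

end

/-! Substitute `t = e ^ (-y)`: a Müntz polynomial becomes an exponential sum `G(y) = ∑ c_z e ^ (-z
y)` on `[0, ∞)`. The exponents are regrouped into clusters, the `j`-th of size at most `D` and
contained in `[L_j, B_j]` with `B_j ≤ Q L_j` and `κ ^ 3 B_j ≤ L_{j+1}`
(`IsQuasiLacunary.exists_clusterSystem`); thus `G = ∑ G_j`. Put `s = r / β`, let `‖G_j‖` be the
supremum on `[0, ∞)`, and set `a_j = ‖G_j‖ L_j ^ (-α/s)`. The proof compares both sides of the
inequality with the sequence `a`.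

Lower bound: `∑ a_j ^ s ≤ C ‖f‖ ^ s` in `L^s(ν_{α-1})` (`IsClusterSystem.sum_expSup_rpow_le`). To
isolate `G_j`, apply operators `G(y) - e ^ (l a) G(y + a)` with `a` comparable to `1 / L_j`. They
annihilate the exponent `l`; for `l = 0` they make slow clusters small; on `G_j` they are bounded
below as long as `l ≤ κ ^ (-3) L_j`. A translation by `K / L_j` then makes the fast clusters small.
What remains is a local `L^1` norm of `G` over `y L_j ∈ [K, K']` plus a small, geometrically
decaying combination of the other `a_i`, which is absorbed in `ℓ^s`. Since `K > 0`, these windows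
overlap boundedly, so the local norms add up to the weighted `L^s` norm.

Upper bound: `|G_j(y)| ≤ C ‖G_j‖ e ^ (-θ L_j y)` for any fixed `θ < 1` (`expSum_decay`), so `|f(t)|`
is at most a positive lacunary sum of `a_j L_j ^ (α/s) t ^ (θ L_j)`. Its `L^r(μ)` norm is controlled
by `(∑ a_j ^ r) ^ (1/r)` (`lintegral_sum_rpow_le`) once the moments satisfy `∫ t ^ (p' λ) dμ ≤ A λ ^
(-α β)` for some `p' < θ r`. Testing the weak type inequality on single monomials gives these
moments for every `p' > p`; the strict inequality `r > p` leaves room for `p < p' < θ r`. Finally `s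
≤ r` gives `∑ a_j ^ r ≤ (∑ a_j ^ s) ^ (r/s)`, and `r / s = β`. -/

/-- The exponential sum `∑ z ∈ S, c z * e ^ (-z y)`. -/
noncomputable def expSum {𝕜 : Type*} [RCLike 𝕜] (S : Finset ℝ) (c : ℝ → 𝕜) (y : ℝ) : 𝕜 :=
  ∑ z ∈ S, ((Real.exp (-z * y) : ℝ) : 𝕜) * c z

/-! ### Sums with boundedly many exponents: Bernstein, decay and growth inequalities. -/

section ExpSum

variable {𝕜 : Type*} [RCLike 𝕜]

lemma expSum_add (S : Finset ℝ) (c d : ℝ → 𝕜) (y : ℝ) :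
    expSum S (fun z => c z + d z) y = expSum S c y + expSum S d y := by
  simp only [expSum, mul_add, Finset.sum_add_distrib]

lemma expSum_const_mul (S : Finset ℝ) (a : 𝕜) (c : ℝ → 𝕜) (y : ℝ) :
    expSum S (fun z => a * c z) y = a * expSum S c y := by
  simp only [expSum, Finset.mul_sum]
  exact Finset.sum_congr rfl fun z _ => by ring

lemma expSum_congr {S : Finset ℝ} {c d : ℝ → 𝕜} (h : ∀ z ∈ S, c z = d z) (y : ℝ) :
    expSum S c y = expSum S d y :=
  Finset.sum_congr rfl fun z hz => by rw [h z hz]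

lemma expSum_erase {S : Finset ℝ} {c : ℝ → 𝕜} {l : ℝ} (h : c l = 0) (y : ℝ) :
    expSum (S.erase l) c y = expSum S c y :=
  Finset.sum_erase _ (by rw [h, mul_zero])

lemma HasDerivAt.rclike_ofReal {f : ℝ → ℝ} {f' y : ℝ} (h : HasDerivAt f f' y) :
    HasDerivAt (fun y => ((f y : ℝ) : 𝕜)) ((f' : ℝ) : 𝕜) y :=
  (RCLike.ofRealCLM (K := 𝕜)).hasFDerivAt.comp_hasDerivAt y h

lemma hasDerivAt_expSum (S : Finset ℝ) (c : ℝ → 𝕜) (y : ℝ) :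
    HasDerivAt (expSum S c) (expSum S (fun z => ((-z : ℝ) : 𝕜) * c z) y) y := by
  have h : ∀ z ∈ S, HasDerivAt (fun y : ℝ => ((Real.exp (-z * y) : ℝ) : 𝕜) * c z)
      (((Real.exp (-z * y) : ℝ) : 𝕜) * (((-z : ℝ) : 𝕜) * c z)) y := by
    intro z _
    have h1 : HasDerivAt (fun y : ℝ => Real.exp (-z * y)) (Real.exp (-z * y) * -z) y := by
      simpa using ((hasDerivAt_id y).const_mul (-z)).exp
    have h2 := (h1.rclike_ofReal (𝕜 := 𝕜)).mul_const (c z)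
    convert h2 using 1
    push_cast
    ring
  exact HasDerivAt.fun_sum h

lemma continuous_expSum (S : Finset ℝ) (c : ℝ → 𝕜) : Continuous (expSum S c) :=
  continuous_iff_continuousAt.2 fun y => (hasDerivAt_expSum S c y).continuousAt

lemma norm_expSum_le {S : Finset ℝ} (hS : ∀ z ∈ S, 0 < z) (c : ℝ → 𝕜) {y : ℝ} (hy : 0 ≤ y) :
    ‖expSum S c y‖ ≤ ∑ z ∈ S, ‖c z‖ := by
  refine (norm_sum_le _ _).trans (Finset.sum_le_sum fun z hz => ?_)
  rw [norm_mul, RCLike.norm_ofReal, abs_of_pos (Real.exp_pos _)]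
  have : Real.exp (-z * y) ≤ 1 := Real.exp_le_one_iff.2 (by nlinarith [hS z hz])
  nlinarith [norm_nonneg (c z)]

/-- A function whose derivative is dominated by the derivative of `g` varies less than `g`. -/
lemma norm_sub_le_of_norm_deriv_le {f f' : ℝ → 𝕜} {g g' : ℝ → ℝ} {a b : ℝ} (hab : a ≤ b)
    (hf : ∀ x, HasDerivAt f (f' x) x) (hg : ∀ x, HasDerivAt g (g' x) x)
    (h : ∀ x, a ≤ x → x ≤ b → ‖f' x‖ ≤ g' x) : ‖f b - f a‖ ≤ g b - g a := by
  have := image_norm_le_of_norm_deriv_right_le_deriv_boundary' (f := fun x => f x - f a) (f' := f')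
    (B := fun x => g x - g a) (B' := g') (a := a) (b := b)
    (fun x _ => ((hf x).sub_const _).continuousAt.continuousWithinAt)
    (fun x _ => ((hf x).sub_const _).hasDerivWithinAt) (by simp)
    (fun x _ => ((hg x).sub_const _).continuousAt.continuousWithinAt)
    (fun x _ => ((hg x).sub_const _).hasDerivWithinAt) (fun x hx => h x hx.1 hx.2.le)
  exact this ⟨hab, le_rfl⟩

/-- The coefficients of `2 l ∫_0^∞ e ^ (-l u) G (y + u) du`, where `G` has coefficients `c`. -/
noncomputable def resolventCoeff (l : ℝ) (c : ℝ → 𝕜) (z : ℝ) : 𝕜 :=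
  ((2 * l / (z + l) : ℝ) : 𝕜) * c z

/-- The coefficients of the difference of `G` and its averages; the one at `l` vanishes. -/
noncomputable def killCoeff (l : ℝ) (c : ℝ → 𝕜) (z : ℝ) : 𝕜 :=
  (((z - l) / (z + l) : ℝ) : 𝕜) * c z

lemma killCoeff_self (l : ℝ) (c : ℝ → 𝕜) : killCoeff l c l = 0 := by simp [killCoeff]

lemma expSum_split {S : Finset ℝ} (hS : ∀ z ∈ S, 0 < z) {l : ℝ} (hl : 0 < l) (c : ℝ → 𝕜) (y : ℝ) :
    expSum S c y = expSum S (resolventCoeff l c) y + expSum S (killCoeff l c) y := by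
  rw [← expSum_add]
  refine expSum_congr (fun z hz => ?_) y
  rw [resolventCoeff, killCoeff, ← add_mul, ← RCLike.ofReal_add]
  have : 2 * l / (z + l) + (z - l) / (z + l) = 1 := by
    have := hS z hz
    field_simp; ring
  rw [this]; simp

lemma hasDerivAt_resolvent {S : Finset ℝ} (hS : ∀ z ∈ S, 0 < z) {l : ℝ} (hl : 0 < l)
    (c : ℝ → 𝕜) (y : ℝ) : HasDerivAt (expSum S (resolventCoeff l c))
      ((l : 𝕜) * expSum S (resolventCoeff l c) y - 2 * (l : 𝕜) * expSum S c y) y := by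
  convert hasDerivAt_expSum S (resolventCoeff l c) y using 1
  rw [← expSum_const_mul, ← expSum_const_mul, sub_eq_add_neg, ← neg_one_mul, ← expSum_const_mul,
    ← expSum_add]
  refine expSum_congr (fun z hz => ?_) y
  simp only [resolventCoeff]
  have h1 : (l * (2 * l / (z + l)) + -1 * (2 * l) : ℝ) = -z * (2 * l / (z + l)) := by
    have := hS z hz
    field_simp; ring
  have h2 : ((l * (2 * l / (z + l)) + -1 * (2 * l) : ℝ) : 𝕜) = ((-z * (2 * l / (z + l)) : ℝ) : 𝕜) := by
    rw [h1]
  push_cast at h2 ⊢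
  linear_combination (c z) * h2

lemma hasDerivAt_exp_mul_const (k y : ℝ) :
    HasDerivAt (fun y : ℝ => Real.exp (k * y)) (k * Real.exp (k * y)) y := by
  have := ((hasDerivAt_id y).const_mul k).exp
  simpa [mul_comm] using this

lemma hasDerivAt_exp_mul_resolvent {S : Finset ℝ} (hS : ∀ z ∈ S, 0 < z) {l : ℝ} (hl : 0 < l)
    (c : ℝ → 𝕜) (k y : ℝ) :
    HasDerivAt (fun y => ((Real.exp (k * y) : ℝ) : 𝕜) * expSum S (resolventCoeff l c) y)
      (((Real.exp (k * y) : ℝ) : 𝕜) * (((k + l : ℝ) : 𝕜) * expSum S (resolventCoeff l c) y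
        - 2 * (l : 𝕜) * expSum S c y)) y := by
  have h2 := ((hasDerivAt_exp_mul_const k y).rclike_ofReal (𝕜 := 𝕜)).fun_mul
    (hasDerivAt_resolvent hS hl c y)
  convert h2 using 1
  push_cast
  ring

/-- The kernel `2 l e ^ (-l u)` on `u ≥ 0` has mass 2 and looks only to the right of `y`, so a bound
on `[y₀, ∞)` is inherited on the same half-line. Instead of the integral, `e ^ (-l y) W(y)` is
compared with `2 b e ^ (-l y)` through their derivatives on `[y, Y]`, and `Y → ∞`. -/
lemma norm_resolvent_le {S : Finset ℝ} (hS : ∀ z ∈ S, 0 < z) {l : ℝ} (hl : 0 < l)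
    {c : ℝ → 𝕜} {b y₀ : ℝ} (h : ∀ y, y₀ ≤ y → ‖expSum S c y‖ ≤ b) {y : ℝ} (hy : y₀ ≤ y) :
    ‖expSum S (resolventCoeff l c) y‖ ≤ 2 * b := by
  set W := expSum S (resolventCoeff l c) with hW
  set w := ∑ z ∈ S, ‖resolventCoeff l c z‖
  have hb : 0 ≤ b := (norm_nonneg _).trans (h y hy)
  have key : ∀ Y, max y 0 ≤ Y → Real.exp (-l * y) * ‖W y‖ ≤
      2 * b * Real.exp (-l * y) + w * Real.exp (-l * Y) := by
    intro Y hY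
    have hyY : y ≤ Y := (le_max_left _ _).trans hY
    have h0Y : 0 ≤ Y := (le_max_right _ _).trans hY
    have h1 := norm_sub_le_of_norm_deriv_le hyY
      (fun x => hasDerivAt_exp_mul_resolvent hS hl c (-l) x)
      (fun x => ((hasDerivAt_exp_mul_const (-l) x).const_mul (-(2 * b)))) (by
        intro x hx _
        have hx' := h x (hy.trans hx)
        rw [neg_add_cancel, RCLike.ofReal_zero, zero_mul, zero_sub, norm_mul, norm_neg, norm_mul,
          norm_mul, RCLike.norm_ofReal, RCLike.norm_ofReal, abs_of_pos (Real.exp_pos _),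
          abs_of_pos hl, RCLike.norm_two]
        have := mul_le_mul_of_nonneg_left hx' (mul_pos (Real.exp_pos (-l * x)) hl).le
        nlinarith)
    have h2 : ‖((Real.exp (-l * y) : ℝ) : 𝕜) * W y‖ ≤
        ‖((Real.exp (-l * Y) : ℝ) : 𝕜) * W Y‖ + ‖((Real.exp (-l * Y) : ℝ) : 𝕜) * W Y -
          ((Real.exp (-l * y) : ℝ) : 𝕜) * W y‖ := by
      rw [norm_sub_rev]
      exact norm_le_insert' _ _
    have h3 : ‖((Real.exp (-l * Y) : ℝ) : 𝕜) * W Y‖ ≤ w * Real.exp (-l * Y) := by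
      rw [norm_mul, RCLike.norm_ofReal, abs_of_pos (Real.exp_pos _), mul_comm]
      exact mul_le_mul_of_nonneg_right (norm_expSum_le hS _ h0Y) (Real.exp_pos _).le
    rw [norm_mul, RCLike.norm_ofReal, abs_of_pos (Real.exp_pos _)] at h2
    have h4 : 0 ≤ 2 * b * Real.exp (-l * Y) := by positivity
    linarith
  have hlim : Tendsto (fun Y : ℝ => 2 * b * Real.exp (-l * y) + w * Real.exp (-l * Y)) atTop
      (nhds (2 * b * Real.exp (-l * y) + w * 0)) := by
    refine Tendsto.const_add _ (Tendsto.const_mul _ ?_)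
    refine Real.tendsto_exp_atBot.comp ?_
    exact tendsto_id.const_mul_atTop_of_neg (neg_lt_zero.2 hl)
  have := ge_of_tendsto hlim (eventually_atTop.2 ⟨max y 0, key⟩)
  have hp := Real.exp_pos (-l * y)
  rw [mul_zero, add_zero, mul_comm] at this
  exact le_of_mul_le_mul_right this hp

lemma norm_kill_le {S : Finset ℝ} (hS : ∀ z ∈ S, 0 < z) {l : ℝ} (hl : 0 < l)
    {c : ℝ → 𝕜} {b y₀ : ℝ} (h : ∀ y, y₀ ≤ y → ‖expSum S c y‖ ≤ b) {y : ℝ} (hy : y₀ ≤ y) :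
    ‖expSum S (killCoeff l c) y‖ ≤ 3 * b := by
  have h1 := expSum_split hS hl c y
  have h2 : expSum S (killCoeff l c) y = expSum S c y - expSum S (resolventCoeff l c) y := by
    rw [h1]; ring
  rw [h2]
  have := norm_sub_le (expSum S c y) (expSum S (resolventCoeff l c) y)
  linarith [h y hy, norm_resolvent_le hS hl h hy]

/-- Bernstein's inequality for exponential sums with at most `n` exponents. -/
theorem expSum_bernstein (𝕜 : Type*) [RCLike 𝕜] (n : ℕ) : ∃ C : ℝ, 1 ≤ C ∧
    ∀ (S : Finset ℝ) (c : ℝ → 𝕜) (B b y₀ : ℝ), S.card ≤ n → (∀ z ∈ S, 0 < z ∧ z ≤ B) → 0 ≤ B →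
      (∀ y, y₀ ≤ y → ‖expSum S c y‖ ≤ b) →
      ∀ y, y₀ ≤ y → ‖expSum S (fun z => ((-z : ℝ) : 𝕜) * c z) y‖ ≤ C * B * b := by
  induction n with
  | zero =>
    refine ⟨1, le_rfl, fun S c B b y₀ hn hS hB h y hy => ?_⟩
    have : S = ∅ := Finset.card_eq_zero.1 (by omega)
    subst this
    have := h y hy
    simp only [expSum, Finset.sum_empty, norm_zero] at this ⊢
    positivity
  | succ n ih =>
    obtain ⟨C, hC, ih⟩ := ih
    -- Split `G` into its average `W` and the part `G - W`, which has one exponent fewer. The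
    -- identity `W' = l W - 2 l G` costs `4 B b`; the induction hypothesis applies to `G - W`,
    -- bounded by `3 b`.
    refine ⟨4 + 3 * C, by linarith, fun S c B b y₀ hn hS hB h y hy => ?_⟩
    have hb : 0 ≤ b := (norm_nonneg _).trans (h y hy)
    rcases S.eq_empty_or_nonempty with rfl | ⟨l, hl⟩
    · simp only [expSum, Finset.sum_empty, norm_zero]
      positivity
    have hpos : ∀ z ∈ S, 0 < z := fun z hz => (hS z hz).1
    have hl0 := hpos l hl
    have h1 := ih (S.erase l) (killCoeff l c) B (3 * b) y₀
      (by rw [Finset.card_erase_of_mem hl]; omega)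
      (fun z hz => hS z (Finset.mem_of_mem_erase hz)) hB
      (fun y hy => by
        rw [expSum_erase (killCoeff_self l c)]; exact norm_kill_le hpos hl0 h hy) y hy
    rw [expSum_erase (by simp [killCoeff_self])] at h1
    have h2 : expSum S (fun z => ((-z : ℝ) : 𝕜) * c z) y =
        ((l : 𝕜) * expSum S (resolventCoeff l c) y - 2 * (l : 𝕜) * expSum S c y) +
          expSum S (fun z => ((-z : ℝ) : 𝕜) * killCoeff l c z) y := by
      have e1 := (hasDerivAt_resolvent hpos hl0 c y).add (hasDerivAt_expSum S (killCoeff l c) y)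
      have e2 := hasDerivAt_expSum S c y
      have e3 : expSum S c = expSum S (resolventCoeff l c) + expSum S (killCoeff l c) :=
        funext fun y => expSum_split hpos hl0 c y
      rw [e3] at e2
      exact e2.unique e1
    rw [h2]
    have h3 := norm_resolvent_le hpos hl0 h hy
    have h4 : ‖(l : 𝕜) * expSum S (resolventCoeff l c) y - 2 * (l : 𝕜) * expSum S c y‖ ≤
        4 * B * b := by
      refine (norm_sub_le _ _).trans ?_
      rw [norm_mul, norm_mul, norm_mul, RCLike.norm_ofReal, RCLike.norm_two, abs_of_pos hl0]
      have h5 := h y hy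
      have h6 := (hS l hl).2
      have h7 := mul_le_mul h6 h3 (norm_nonneg _) hB
      have h8 := mul_le_mul h6 h5 (norm_nonneg _) hB
      linarith
    refine (norm_add_le _ _).trans ?_
    linarith

/-- Exponential sums with at most `n` exponents, all at least `L`, decay almost like `e ^ (-L y)`. -/
theorem expSum_decay (𝕜 : Type*) [RCLike 𝕜] {θ : ℝ} (hθ0 : 0 < θ) (hθ : θ < 1) (n : ℕ) :
    ∃ C : ℝ, 1 ≤ C ∧ ∀ (S : Finset ℝ) (c : ℝ → 𝕜) (L b : ℝ), S.card ≤ n → 0 < L →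
      (∀ z ∈ S, L ≤ z) → (∀ y, 0 ≤ y → ‖expSum S c y‖ ≤ b) →
      ∀ y, 0 ≤ y → ‖expSum S c y‖ ≤ C * b * Real.exp (-(θ * L) * y) := by
  induction n with
  | zero =>
    refine ⟨1, le_rfl, fun S c L b hn hL hS h y hy => ?_⟩
    have : S = ∅ := Finset.card_eq_zero.1 (by omega)
    subst this
    have := h y hy
    simp only [expSum, Finset.sum_empty, norm_zero] at this ⊢
    positivity
  | succ n ih =>
    obtain ⟨C, hC, ih⟩ := ih
    have hC' : 0 ≤ 6 * C / (1 - θ) := div_nonneg (by linarith) (by linarith)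
    refine ⟨2 + 6 * C / (1 - θ) + 3 * C, by linarith, fun S c L b hn hL hS h y hy => ?_⟩
    have hb : 0 ≤ b := (norm_nonneg _).trans (h y hy)
    rcases S.eq_empty_or_nonempty with rfl | ⟨l, hl⟩
    · simp only [expSum, Finset.sum_empty, norm_zero]
      positivity
    have hpos : ∀ z ∈ S, 0 < z := fun z hz => hL.trans_le (hS z hz)
    have hl0 := hpos l hl
    have hlL := hS l hl
    have hk : ∀ y, 0 ≤ y → ‖expSum S (killCoeff l c) y‖ ≤ C * (3 * b) * Real.exp (-(θ * L) * y) := by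
      intro y hy
      have h1 := ih (S.erase l) (killCoeff l c) L (3 * b)
        (by rw [Finset.card_erase_of_mem hl]; omega) hL
        (fun z hz => hS z (Finset.mem_of_mem_erase hz))
        (fun y hy => by
          rw [expSum_erase (killCoeff_self l c)]; exact norm_kill_le hpos hl0 h hy) y hy
      rwa [expSum_erase (killCoeff_self l c)] at h1
    set W := expSum S (resolventCoeff l c) with hW
    have hd : 0 < l - θ * L := by nlinarith
    -- The derivative of `e ^ (l y) W` is `-2 l e ^ (l y) (G - W)`: it involves only the part
    -- without the exponent `l`, whose decay is known by induction. Integrating from `0` to `y`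
    -- transfers the decay to `W`.
    have h1 := norm_sub_le_of_norm_deriv_le hy
      (fun x => hasDerivAt_exp_mul_resolvent hpos hl0 c l x)
      (fun x => ((hasDerivAt_exp_mul_const (l - θ * L) x).const_mul (6 * C * b * l / (l - θ * L))))
      (by
        intro x hx _
        have e1 : ((l + l : ℝ) : 𝕜) * W x - 2 * (l : 𝕜) * expSum S c x =
            -(2 * (l : 𝕜) * expSum S (killCoeff l c) x) := by
          rw [expSum_split hpos hl0 c x]; push_cast; ring
        rw [e1, norm_mul, norm_neg, norm_mul,
          norm_mul, RCLike.norm_ofReal, RCLike.norm_ofReal, abs_of_pos (Real.exp_pos _),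
          abs_of_pos hl0, RCLike.norm_two]
        have e2 : 6 * C * b * l / (l - θ * L) * ((l - θ * L) * Real.exp ((l - θ * L) * x)) =
            Real.exp (l * x) * (2 * l * (C * (3 * b) * Real.exp (-(θ * L) * x))) := by
          have : Real.exp ((l - θ * L) * x) = Real.exp (l * x) * Real.exp (-(θ * L) * x) := by
            rw [← Real.exp_add]; ring_nf
          rw [this]; field_simp; ring
        rw [e2]
        have := hk x hx
        gcongr)
    have hW0 := norm_resolvent_le hpos hl0 h (le_refl (0 : ℝ))
    have h2 : ‖((Real.exp (l * y) : ℝ) : 𝕜) * W y‖ ≤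
        ‖((Real.exp (l * 0) : ℝ) : 𝕜) * W 0‖ + ‖((Real.exp (l * y) : ℝ) : 𝕜) * W y -
          ((Real.exp (l * 0) : ℝ) : 𝕜) * W 0‖ := norm_le_insert' _ _
    -- The loss `θ < 1` in the exponent is spent here: `l - θ L ≥ (1 - θ) l` makes the constant
    -- independent of the exponents.
    have h3 : 6 * C * b * l / (l - θ * L) ≤ 6 * C / (1 - θ) * b := by
      rw [div_mul_eq_mul_div, div_le_div_iff₀ hd (by linarith)]
      have : l * (1 - θ) ≤ l - θ * L := by nlinarith
      have h6 : 0 ≤ 6 * C * b := by positivity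
      nlinarith
    have h4 : Real.exp (l * y) * ‖W y‖ ≤ (2 * b + 6 * C / (1 - θ) * b) * Real.exp ((l - θ * L) * y) := by
      rw [norm_mul, RCLike.norm_ofReal, abs_of_pos (Real.exp_pos _)] at h2
      simp only [mul_zero, Real.exp_zero, RCLike.ofReal_one, one_mul, mul_one] at h1 h2
      have e1 : 1 ≤ Real.exp ((l - θ * L) * y) := Real.one_le_exp (by positivity)
      have e2 : 0 ≤ 6 * C * b * l / (l - θ * L) := by positivity
      nlinarith
    have h5 : ‖W y‖ ≤ (2 * b + 6 * C / (1 - θ) * b) * Real.exp (-(θ * L) * y) := by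
      have : Real.exp ((l - θ * L) * y) = Real.exp (l * y) * Real.exp (-(θ * L) * y) := by
        rw [← Real.exp_add]; ring_nf
      rw [this] at h4
      refine le_of_mul_le_mul_left (h4.trans_eq ?_) (Real.exp_pos (l * y))
      ring
    rw [expSum_split hpos hl0 c y]
    refine (norm_add_le _ _).trans ?_
    have := hk y hy
    linarith

/-- Exponential sums with at most `n` exponents, all at most `B`, grow to the left at most almost
like `e ^ (-B y)`. -/
theorem expSum_growth (𝕜 : Type*) [RCLike 𝕜] {κ : ℝ} (hκ : 1 < κ) (n : ℕ) :
    ∃ C : ℝ, 1 ≤ C ∧ ∀ (S : Finset ℝ) (c : ℝ → 𝕜) (B b K : ℝ), S.card ≤ n → 0 < B →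
      (∀ z ∈ S, 0 < z ∧ z ≤ B) → (∀ y, K ≤ y → ‖expSum S c y‖ ≤ b) →
      ∀ y, y ≤ K → ‖expSum S c y‖ ≤ C * b * Real.exp (κ * B * (K - y)) := by
  induction n with
  | zero =>
    refine ⟨1, le_rfl, fun S c B b K hn hB hS h y hy => ?_⟩
    have : S = ∅ := Finset.card_eq_zero.1 (by omega)
    subst this
    have := h K le_rfl
    simp only [expSum, Finset.sum_empty, norm_zero] at this ⊢
    positivity
  | succ n ih =>
    obtain ⟨C, hC, ih⟩ := ih
    have hC' : 0 ≤ 6 * C / (κ - 1) := div_nonneg (by linarith) (by linarith)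
    refine ⟨2 + 6 * C / (κ - 1) + 3 * C, by linarith, fun S c B b K hn hB hS h y hy => ?_⟩
    have hb : 0 ≤ b := (norm_nonneg _).trans (h K le_rfl)
    rcases S.eq_empty_or_nonempty with rfl | ⟨l, hl⟩
    · simp only [expSum, Finset.sum_empty, norm_zero]
      positivity
    have hpos : ∀ z ∈ S, 0 < z := fun z hz => (hS z hz).1
    have hl0 := hpos l hl
    have hlB := (hS l hl).2
    have hk : ∀ y, y ≤ K →
        ‖expSum S (killCoeff l c) y‖ ≤ C * (3 * b) * Real.exp (κ * B * (K - y)) := by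
      intro y hy
      have h1 := ih (S.erase l) (killCoeff l c) B (3 * b) K
        (by rw [Finset.card_erase_of_mem hl]; omega) hB
        (fun z hz => hS z (Finset.mem_of_mem_erase hz))
        (fun y hy => by
          rw [expSum_erase (killCoeff_self l c)]; exact norm_kill_le hpos hl0 h hy) y hy
      rwa [expSum_erase (killCoeff_self l c)] at h1
    set W := expSum S (resolventCoeff l c) with hW
    have hd : 0 < κ * B - l := by nlinarith
    set A := 6 * C * b * l / (κ * B - l) with hA
    have hA0 : 0 ≤ A := by positivity
    -- As for the decay, but integrating from `y` up to `K`; now `κ > 1` keeps `κ B - l` comparable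
    -- to `l` or larger.
    have h1 := norm_sub_le_of_norm_deriv_le hy
      (fun x => hasDerivAt_exp_mul_resolvent hpos hl0 c l x)
      (fun x => ((hasDerivAt_exp_mul_const (-(κ * B - l)) x).const_mul
        (-(A * Real.exp (κ * B * K)))))
      (by
        intro x _ hx
        have e1 : ((l + l : ℝ) : 𝕜) * W x - 2 * (l : 𝕜) * expSum S c x =
            -(2 * (l : 𝕜) * expSum S (killCoeff l c) x) := by
          rw [expSum_split hpos hl0 c x]; push_cast; ring
        rw [e1, norm_mul, norm_neg, norm_mul,
          norm_mul, RCLike.norm_ofReal, RCLike.norm_ofReal, abs_of_pos (Real.exp_pos _),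
          abs_of_pos hl0, RCLike.norm_two]
        have e2 : -(A * Real.exp (κ * B * K)) *
              (-(κ * B - l) * Real.exp (-(κ * B - l) * x)) =
            Real.exp (l * x) * (2 * l * (C * (3 * b) * Real.exp (κ * B * (K - x)))) := by
          have : Real.exp (κ * B * K) * Real.exp (-(κ * B - l) * x) =
              Real.exp (l * x) * Real.exp (κ * B * (K - x)) := by
            rw [← Real.exp_add, ← Real.exp_add]; ring_nf
          calc _ = A * (κ * B - l) * (Real.exp (κ * B * K) * Real.exp (-(κ * B - l) * x)) := by ring
            _ = 6 * C * b * l * (Real.exp (l * x) * Real.exp (κ * B * (K - x))) := by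
                rw [this, hA]; field_simp
            _ = _ := by ring
        rw [e2]
        have := hk x hx
        gcongr)
    have hWK := norm_resolvent_le hpos hl0 h (le_refl K)
    have h2 : ‖((Real.exp (l * y) : ℝ) : 𝕜) * W y‖ ≤
        ‖((Real.exp (l * K) : ℝ) : 𝕜) * W K‖ + ‖((Real.exp (l * K) : ℝ) : 𝕜) * W K -
          ((Real.exp (l * y) : ℝ) : 𝕜) * W y‖ := by
      rw [norm_sub_rev]; exact norm_le_insert' _ _
    have h3 : A ≤ 6 * C / (κ - 1) * b := by
      rw [hA, div_mul_eq_mul_div, div_le_div_iff₀ hd (by linarith)]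
      have : l * (κ - 1) ≤ κ * B - l := by nlinarith
      have h6 : 0 ≤ 6 * C * b := by positivity
      nlinarith
    have h4 : Real.exp (l * y) * ‖W y‖ ≤
        2 * b * Real.exp (l * K) + A * (Real.exp (l * y) * Real.exp (κ * B * (K - y))) := by
      rw [norm_mul, norm_mul, RCLike.norm_ofReal, RCLike.norm_ofReal, abs_of_pos (Real.exp_pos _),
        abs_of_pos (Real.exp_pos _)] at h2
      have e1 : Real.exp (l * y) * Real.exp (κ * B * (K - y)) =
          Real.exp (κ * B * K) * Real.exp (-(κ * B - l) * y) := by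
        rw [← Real.exp_add, ← Real.exp_add]; ring_nf
      rw [e1]
      have e2 : 0 ≤ A * (Real.exp (κ * B * K) * Real.exp (-(κ * B - l) * K)) := by positivity
      have e3 := mul_le_mul_of_nonneg_left hWK (Real.exp_pos (l * K)).le
      linarith
    have h5 : ‖W y‖ ≤ 2 * b * Real.exp (l * (K - y)) + A * Real.exp (κ * B * (K - y)) := by
      have : Real.exp (l * K) = Real.exp (l * y) * Real.exp (l * (K - y)) := by
        rw [← Real.exp_add]; ring_nf
      rw [this] at h4
      refine le_of_mul_le_mul_left (h4.trans_eq ?_) (Real.exp_pos (l * y))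
      ring
    have h6 : Real.exp (l * (K - y)) ≤ Real.exp (κ * B * (K - y)) :=
      Real.exp_le_exp.2 (mul_le_mul_of_nonneg_right (by nlinarith) (by linarith))
    rw [expSum_split hpos hl0 c y]
    refine (norm_add_le _ _).trans ?_
    have := hk y hy
    have h7 : 2 * b * Real.exp (l * (K - y)) ≤ 2 * b * Real.exp (κ * B * (K - y)) := by gcongr
    have h8 : A * Real.exp (κ * B * (K - y)) ≤ 6 * C / (κ - 1) * b * Real.exp (κ * B * (K - y)) := by
      gcongr
    linarith

end ExpSum

/-! ### Difference and translation operators in the supremum norm. -/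

section ExpSup

variable {𝕜 : Type*} [RCLike 𝕜]

/-- The supremum of an exponential sum over the half-line `[0, ∞)`. -/
noncomputable def expSup (S : Finset ℝ) (c : ℝ → 𝕜) : ℝ := ⨆ y : {y : ℝ // 0 ≤ y}, ‖expSum S c y‖

lemma norm_expSum_le_expSup {S : Finset ℝ} (hS : ∀ z ∈ S, 0 < z) (c : ℝ → 𝕜) {y : ℝ} (hy : 0 ≤ y) :
    ‖expSum S c y‖ ≤ expSup S c :=
  le_ciSup (f := fun y : {y : ℝ // 0 ≤ y} => ‖expSum S c y‖)
    ⟨∑ z ∈ S, ‖c z‖, by rintro _ ⟨y, rfl⟩; exact norm_expSum_le hS c y.2⟩ ⟨y, hy⟩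

lemma expSup_le {S : Finset ℝ} {c : ℝ → 𝕜} {b : ℝ} (h : ∀ y, 0 ≤ y → ‖expSum S c y‖ ≤ b) :
    expSup S c ≤ b :=
  haveI : Nonempty {y : ℝ // 0 ≤ y} := ⟨⟨0, le_rfl⟩⟩
  ciSup_le fun y => h y y.2

lemma expSup_nonneg (S : Finset ℝ) (c : ℝ → 𝕜) : 0 ≤ expSup S c :=
  Real.iSup_nonneg fun _ => norm_nonneg _

lemma expSup_eq_zero {S : Finset ℝ} {c : ℝ → 𝕜} (h : ∀ z ∈ S, c z = 0) : expSup S c = 0 := by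
  refine le_antisymm (expSup_le fun y _ => ?_) (expSup_nonneg _ _)
  rw [expSum, Finset.sum_eq_zero fun z hz => by rw [h z hz, mul_zero], norm_zero]

/-- The coefficients of `G (y + a)`, where `G` has coefficients `c`. -/
noncomputable def shiftCoeff (a : ℝ) (c : ℝ → 𝕜) (z : ℝ) : 𝕜 := ((Real.exp (-z * a) : ℝ) : 𝕜) * c z

/-- The coefficients of `G y - e ^ (l a) G (y + a)`, where `G` has coefficients `c`. -/
noncomputable def diffCoeff (a l : ℝ) (c : ℝ → 𝕜) (z : ℝ) : 𝕜 :=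
  ((1 - Real.exp (-(z - l) * a) : ℝ) : 𝕜) * c z

lemma expSum_shiftCoeff (S : Finset ℝ) (a : ℝ) (c : ℝ → 𝕜) (y : ℝ) :
    expSum S (shiftCoeff a c) y = expSum S c (y + a) := by
  refine Finset.sum_congr rfl fun z _ => ?_
  rw [shiftCoeff, ← mul_assoc, ← RCLike.ofReal_mul, ← Real.exp_add, mul_add]

lemma expSum_diffCoeff (S : Finset ℝ) (a l : ℝ) (c : ℝ → 𝕜) (y : ℝ) :
    expSum S (diffCoeff a l c) y =
      expSum S c y - ((Real.exp (l * a) : ℝ) : 𝕜) * expSum S c (y + a) := by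
  rw [expSum, expSum, expSum, Finset.mul_sum, ← Finset.sum_sub_distrib]
  refine Finset.sum_congr rfl fun z _ => ?_
  have : Real.exp (l * a) * Real.exp (-z * (y + a)) =
      Real.exp (-z * y) * Real.exp (-(z - l) * a) := by
    rw [← Real.exp_add, ← Real.exp_add]; ring_nf
  rw [diffCoeff, ← mul_assoc, ← mul_assoc, ← RCLike.ofReal_mul, ← RCLike.ofReal_mul, this,
    mul_sub, mul_one]
  push_cast
  ring

lemma expSup_diffCoeff_le {S : Finset ℝ} (hS : ∀ z ∈ S, 0 < z) {a : ℝ} (ha : 0 ≤ a) (l : ℝ)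
    (c : ℝ → 𝕜) : expSup S (diffCoeff a l c) ≤ (1 + Real.exp (l * a)) * expSup S c := by
  refine expSup_le fun y hy => ?_
  rw [expSum_diffCoeff]
  refine (norm_sub_le _ _).trans ?_
  rw [norm_mul, RCLike.norm_ofReal, abs_of_pos (Real.exp_pos _), one_add_mul]
  have h1 := norm_expSum_le_expSup hS c hy
  have h2 := norm_expSum_le_expSup hS c (add_nonneg hy ha)
  gcongr

/-- Bernstein's inequality integrated over `[y, y + a]`. When `B a` is small, a plain difference
almost annihilates the sum; this is how clusters far below the current one are suppressed. -/
theorem expSup_diffCoeff_zero_le (𝕜 : Type*) [RCLike 𝕜] (n : ℕ) : ∃ C : ℝ, 1 ≤ C ∧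
    ∀ (S : Finset ℝ) (c : ℝ → 𝕜) (B a : ℝ), S.card ≤ n → (∀ z ∈ S, 0 < z ∧ z ≤ B) → 0 ≤ B → 0 ≤ a →
      expSup S (diffCoeff a 0 c) ≤ C * (B * a) * expSup S c := by
  obtain ⟨C, hC, h⟩ := expSum_bernstein 𝕜 n
  refine ⟨C, hC, fun S c B a hn hS hB ha => expSup_le fun y hy => ?_⟩
  rw [expSum_diffCoeff, zero_mul, Real.exp_zero, RCLike.ofReal_one, one_mul, norm_sub_rev]
  have := norm_sub_le_of_norm_deriv_le (a := y) (b := y + a) (by linarith)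
    (fun x => hasDerivAt_expSum S c x)
    (fun x => (hasDerivAt_id x).const_mul (C * B * expSup S c)) (fun x hx _ => by
      rw [mul_one]
      exact h S c B _ 0 hn hS hB (fun y hy => norm_expSum_le_expSup (fun z hz => (hS z hz).1) c hy)
        x (hy.trans hx))
  refine this.trans_eq ?_
  simp only [id]
  ring

/-- At distance `X / L` the sum has decayed faster than `e ^ (l X / L)` grows, because the decay
rate `(1 + τ) / 2` beats `τ`. For large `X` the translated term is at most half of the supremum, so
annihilating a lower exponent costs only a factor 2. -/
theorem expSup_le_diffCoeff (𝕜 : Type*) [RCLike 𝕜] {τ : ℝ} (hτ0 : 0 < τ) (hτ : τ < 1) (n : ℕ) :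
    ∃ X : ℝ, 1 ≤ X ∧ ∀ (S : Finset ℝ) (c : ℝ → 𝕜) (L l : ℝ), S.card ≤ n → 0 < L →
      (∀ z ∈ S, L ≤ z) → l ≤ τ * L →
      expSup S c ≤ 2 * expSup S (diffCoeff (X / L) l c) := by
  obtain ⟨C, hC, h⟩ := expSum_decay 𝕜 (θ := (1 + τ) / 2) (by linarith) (by linarith) n
  have hlim : Tendsto (fun X : ℝ => C * Real.exp (-((1 - τ) / 2) * X)) atTop (nhds (C * 0)) :=
    Tendsto.const_mul _ (Real.tendsto_exp_atBot.comp
      (tendsto_id.const_mul_atTop_of_neg (by linarith)))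
  rw [mul_zero] at hlim
  obtain ⟨X, hX1, hX2⟩ := ((eventually_ge_atTop (1 : ℝ)).and
    (hlim.eventually (ge_mem_nhds (show (0 : ℝ) < 1 / 2 by norm_num)))).exists
  refine ⟨X, hX1, fun S c L l hn hL hS hl => ?_⟩
  have hpos : ∀ z ∈ S, 0 < z := fun z hz => hL.trans_le (hS z hz)
  have hb := expSup_nonneg S c
  suffices expSup S c ≤ expSup S (diffCoeff (X / L) l c) + 1 / 2 * expSup S c by linarith
  have hXL : 0 < X / L := by positivity
  refine expSup_le fun y hy => ?_
  have h1 : expSum S c y = expSum S (diffCoeff (X / L) l c) y +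
      ((Real.exp (l * (X / L)) : ℝ) : 𝕜) * expSum S c (y + X / L) := by
    rw [expSum_diffCoeff]; ring
  rw [h1]
  refine (norm_add_le _ _).trans (add_le_add (norm_expSum_le_expSup hpos _ hy) ?_)
  rw [norm_mul, RCLike.norm_ofReal, abs_of_pos (Real.exp_pos _)]
  have h2 := h S c L _ hn hL hS (fun y hy => norm_expSum_le_expSup hpos c hy) (y + X / L)
    (by positivity)
  have h3 : Real.exp (l * (X / L)) * Real.exp (-((1 + τ) / 2 * L) * (y + X / L)) ≤
      Real.exp (-((1 - τ) / 2) * X) := by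
    rw [← Real.exp_add]
    refine Real.exp_le_exp.2 ?_
    have e1 : l * (X / L) ≤ τ * X := by
      calc l * (X / L) ≤ τ * L * (X / L) := by gcongr
        _ = τ * X := by field_simp
    have e2 : (1 + τ) / 2 * L * (X / L) = (1 + τ) / 2 * X := by field_simp
    have e3 : 0 ≤ (1 + τ) / 2 * L * y := by positivity
    linarith
  calc _ ≤ Real.exp (l * (X / L)) * (C * expSup S c * Real.exp (-((1 + τ) / 2 * L) * (y + X / L))) := by
        gcongr
    _ = C * expSup S c * (Real.exp (l * (X / L)) * Real.exp (-((1 + τ) / 2 * L) * (y + X / L))) := by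
        ring
    _ ≤ C * expSup S c * Real.exp (-((1 - τ) / 2) * X) := by gcongr
    _ = C * Real.exp (-((1 - τ) / 2) * X) * expSup S c := by ring
    _ ≤ _ := by gcongr

theorem expSup_shiftCoeff_le (𝕜 : Type*) [RCLike 𝕜] {θ : ℝ} (hθ0 : 0 < θ) (hθ : θ < 1) (n : ℕ) :
    ∃ C : ℝ, 1 ≤ C ∧ ∀ (S : Finset ℝ) (c : ℝ → 𝕜) (L K : ℝ), S.card ≤ n → 0 < L →
      (∀ z ∈ S, L ≤ z) → 0 ≤ K →
      expSup S (shiftCoeff K c) ≤ C * Real.exp (-(θ * L) * K) * expSup S c := by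
  obtain ⟨C, hC, h⟩ := expSum_decay 𝕜 hθ0 hθ n
  refine ⟨C, hC, fun S c L K hn hL hS hK => expSup_le fun y hy => ?_⟩
  have hpos : ∀ z ∈ S, 0 < z := fun z hz => hL.trans_le (hS z hz)
  have hb := expSup_nonneg S c
  rw [expSum_shiftCoeff]
  refine (h S c L _ hn hL hS (fun y hy => norm_expSum_le_expSup hpos c hy) _ (by positivity)).trans ?_
  have : Real.exp (-(θ * L) * (y + K)) ≤ Real.exp (-(θ * L) * K) :=
    Real.exp_le_exp.2 (by have : 0 ≤ θ * L * y := by positivity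
                          linarith)
  calc _ ≤ C * expSup S c * Real.exp (-(θ * L) * K) := by gcongr
    _ = _ := by ring

/-- Restricting the sum to `[K, ∞)` loses only a controlled factor. The rate `κ B`, with `κ` close
to 1, must stay below the rate at which the same translation damps faster clusters. -/
theorem expSup_le_shiftCoeff (𝕜 : Type*) [RCLike 𝕜] {κ : ℝ} (hκ : 1 < κ) (n : ℕ) :
    ∃ C : ℝ, 1 ≤ C ∧ ∀ (S : Finset ℝ) (c : ℝ → 𝕜) (B K : ℝ), S.card ≤ n → 0 < B →
      (∀ z ∈ S, 0 < z ∧ z ≤ B) → 0 ≤ K →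
      expSup S c ≤ C * Real.exp (κ * B * K) * expSup S (shiftCoeff K c) := by
  obtain ⟨C, hC, h⟩ := expSum_growth 𝕜 hκ n
  refine ⟨C, hC, fun S c B K hn hB hS hK => expSup_le fun y hy => ?_⟩
  have hpos : ∀ z ∈ S, 0 < z := fun z hz => (hS z hz).1
  have hb := expSup_nonneg S (shiftCoeff K c)
  have h1 : ∀ y, K ≤ y → ‖expSum S c y‖ ≤ expSup S (shiftCoeff K c) := by
    intro y hy
    have := norm_expSum_le_expSup hpos (shiftCoeff K c) (y := y - K) (by linarith)
    rwa [expSum_shiftCoeff, sub_add_cancel] at this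
  rcases le_total K y with hKy | hKy
  · refine (h1 y hKy).trans (le_mul_of_one_le_left hb ?_)
    have : 1 ≤ Real.exp (κ * B * K) := Real.one_le_exp (by positivity)
    nlinarith
  · refine (h S c B _ K hn hB hS h1 y hKy).trans ?_
    have : Real.exp (κ * B * (K - y)) ≤ Real.exp (κ * B * K) :=
      Real.exp_le_exp.2 (mul_le_mul_of_nonneg_left (by linarith) (by positivity))
    calc _ ≤ C * expSup S (shiftCoeff K c) * Real.exp (κ * B * K) := by gcongr
      _ = _ := by ring

/-- The supremum of an exponential sum with exponents in `[L, Q L]` is controlled by a local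
`L^1` norm at scale `1 / L`. -/
theorem expSup_le_integral (𝕜 : Type*) [RCLike 𝕜] {Q : ℝ} (hQ : 1 ≤ Q) (n : ℕ) :
    ∃ C Y : ℝ, 0 < C ∧ 0 < Y ∧ ∀ (S : Finset ℝ) (c : ℝ → 𝕜) (L : ℝ), S.card ≤ n → 0 < L →
      (∀ z ∈ S, L ≤ z ∧ z ≤ Q * L) →
      expSup S c ≤ C * ∫ x in (0 : ℝ)..Y, ‖expSum S c (x / L)‖ := by
  obtain ⟨C₁, hC₁, h₁⟩ := expSum_decay 𝕜 (θ := 1 / 2) (by norm_num) (by norm_num) n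
  obtain ⟨C₂, hC₂, h₂⟩ := expSum_bernstein 𝕜 n
  have hlim : Tendsto (fun X : ℝ => C₁ * Real.exp (-(1 / 2) * X)) atTop (nhds (C₁ * 0)) :=
    Tendsto.const_mul _ (Real.tendsto_exp_atBot.comp
      (tendsto_id.const_mul_atTop_of_neg (by linarith)))
  rw [mul_zero] at hlim
  obtain ⟨X, hX1, hX2⟩ := ((eventually_ge_atTop (1 : ℝ)).and
    (hlim.eventually (ge_mem_nhds (show (0 : ℝ) < 1 / 4 by norm_num)))).exists
  have hq : 0 < C₂ * Q := by positivity
  -- In the variable `x = y L`, Bernstein bounds the slope by `C₂ Q b`, so over a length `h` the sum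
  -- varies by at most `b / 4`.
  set h := 1 / (4 * (C₂ * Q)) with hh
  have hh0 : 0 < h := by positivity
  refine ⟨2 / h, X + h, by positivity, by positivity, fun S c L hn hL hS => ?_⟩
  have hpos : ∀ z ∈ S, 0 < z := fun z hz => hL.trans_le (hS z hz).1
  have hcont : Continuous fun x : ℝ => ‖expSum S c (x / L)‖ :=
    ((continuous_expSum S c).comp (continuous_id.div_const L)).norm
  set b := expSup S c with hbdef
  have hb : 0 ≤ b := expSup_nonneg S c
  set T := ∫ x in (0 : ℝ)..(X + h), ‖expSum S c (x / L)‖ with hT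
  have hT0 : 0 ≤ T := intervalIntegral.integral_nonneg (by positivity) fun x _ => norm_nonneg _
  suffices b ≤ 1 / h * T + 1 / 2 * b by
    have e : 2 / h * T = 2 * (1 / h * T) := by ring
    linarith
  refine expSup_le fun y hy => ?_
  -- Beyond `X / L` decay already gives at most `b / 4`. Before it, the value at `y` is within `b /
  -- 4` of the values on an interval of length `h`, and is bounded by averaging over it.
  rcases le_total X (y * L) with hXy | hXy
  · have h1 := h₁ S c L b hn hL (fun z hz => (hS z hz).1)
      (fun y hy => norm_expSum_le_expSup hpos c hy) y hy
    have h3 : Real.exp (-(1 / 2 * L) * y) ≤ Real.exp (-(1 / 2) * X) :=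
      Real.exp_le_exp.2 (by linarith)
    have h4 : 0 ≤ 1 / h * T := by positivity
    calc _ ≤ C₁ * b * Real.exp (-(1 / 2) * X) := h1.trans (by gcongr)
      _ = C₁ * Real.exp (-(1 / 2) * X) * b := by ring
      _ ≤ 1 / 4 * b := by gcongr
      _ ≤ _ := by linarith
  · have hyL : 0 ≤ y * L := by positivity
    have h3 : ∀ x, y * L ≤ x → x ≤ y * L + h → ‖expSum S c y‖ ≤ ‖expSum S c (x / L)‖ + 1 / 4 * b := by
      intro x hx hx'
      have hyx : y ≤ x / L := by rwa [le_div_iff₀ hL]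
      have h4 := norm_sub_le_of_norm_deriv_le hyx (fun x => hasDerivAt_expSum S c x)
        (fun x => (hasDerivAt_id x).const_mul (C₂ * (Q * L) * b)) (fun x hx _ => by
          rw [mul_one]
          exact h₂ S c (Q * L) b 0 hn (fun z hz => ⟨hpos z hz, (hS z hz).2⟩) (by positivity)
            (fun y hy => norm_expSum_le_expSup hpos c hy) x (hy.trans hx))
      have h5 : C₂ * (Q * L) * b * (x / L) - C₂ * (Q * L) * b * y ≤ 1 / 4 * b := by
        have : C₂ * (Q * L) * b * (x / L) - C₂ * (Q * L) * b * y = C₂ * Q * b * (x - y * L) := by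
          field_simp
        rw [this]
        calc _ ≤ C₂ * Q * b * h := by gcongr; linarith
          _ = _ := by rw [hh]; field_simp
      have h6 := norm_le_insert' (expSum S c y) (expSum S c (x / L))
      rw [norm_sub_rev] at h6
      simp only [id] at h4
      linarith
    have h4 : h * ‖expSum S c y‖ ≤ T + h * (1 / 4 * b) := by
      have e1 : ∫ _ in (y * L)..(y * L + h), ‖expSum S c y‖ ≤
          ∫ x in (y * L)..(y * L + h), (‖expSum S c (x / L)‖ + 1 / 4 * b) :=
        intervalIntegral.integral_mono_on (by linarith) (by simp)
          ((hcont.add continuous_const).intervalIntegrable _ _) fun x hx => h3 x hx.1 hx.2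
      rw [intervalIntegral.integral_add (hcont.intervalIntegrable _ _) (by simp),
        intervalIntegral.integral_const, intervalIntegral.integral_const] at e1
      have e2 : ∫ x in (y * L)..(y * L + h), ‖expSum S c (x / L)‖ ≤ T :=
        intervalIntegral.integral_mono_interval hyL (by linarith) (by linarith)
          (Eventually.of_forall fun x => norm_nonneg _) (hcont.intervalIntegrable _ _)
      simp only [add_sub_cancel_left, smul_eq_mul] at e1
      linarith
    have h5 : ‖expSum S c y‖ ≤ (T + h * (1 / 4 * b)) / h := by
      rw [le_div_iff₀ hh0]; linarith
    refine h5.trans ?_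
    rw [add_div, mul_div_cancel_left₀ _ hh0.ne', one_div_mul_eq_div]
    have e : 1 / h * T = T / h := by ring
    rw [e]
    linarith

/-- Successive application of `diffCoeff a l` for `l` in a list. -/
noncomputable def diffListCoeff (a : ℝ) (ls : List ℝ) (c : ℝ → 𝕜) : ℝ → 𝕜 :=
  ls.foldr (fun l c => diffCoeff a l c) c

lemma diffListCoeff_cons (a l : ℝ) (ls : List ℝ) (c : ℝ → 𝕜) :
    diffListCoeff a (l :: ls) c = diffCoeff a l (diffListCoeff a ls c) := rfl

lemma diffListCoeff_eq_zero {a z : ℝ} {ls : List ℝ} (hz : z ∈ ls) (c : ℝ → 𝕜) :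
    diffListCoeff a ls c z = 0 := by
  induction ls with
  | nil => simp at hz
  | cons l ls ih =>
    rw [diffListCoeff_cons, diffCoeff]
    rcases List.mem_cons.1 hz with rfl | h
    · simp
    · rw [ih h, mul_zero]

lemma expSup_diffListCoeff_le {S : Finset ℝ} (hS : ∀ z ∈ S, 0 < z) {X L : ℝ} (hX : 0 ≤ X)
    (hL : 0 < L) (ls : List ℝ) (hls : ∀ l ∈ ls, l ≤ L) (c : ℝ → 𝕜) :
    expSup S (diffListCoeff (X / L) ls c) ≤ (1 + Real.exp X) ^ ls.length * expSup S c := by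
  induction ls with
  | nil => simp [diffListCoeff]
  | cons l ls ih =>
    rw [diffListCoeff_cons, List.length_cons, pow_succ']
    refine (expSup_diffCoeff_le hS (by positivity) _ _).trans ?_
    have h1 := ih fun l hl => hls l (List.mem_cons_of_mem _ hl)
    have h2 : Real.exp (l * (X / L)) ≤ Real.exp X := by
      refine Real.exp_le_exp.2 ?_
      calc l * (X / L) ≤ L * (X / L) := by
            gcongr; exact hls l List.mem_cons_self
        _ = X := by field_simp
    have h3 := expSup_nonneg S c
    rw [mul_assoc]
    have h4 := expSup_nonneg S (diffListCoeff (X / L) ls c)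
    gcongr

lemma expSup_le_diffListCoeff {S : Finset ℝ} {a : ℝ} {ls : List ℝ}
    (h : ∀ l ∈ ls, ∀ c : ℝ → 𝕜, expSup S c ≤ 2 * expSup S (diffCoeff a l c)) (c : ℝ → 𝕜) :
    expSup S c ≤ 2 ^ ls.length * expSup S (diffListCoeff a ls c) := by
  induction ls with
  | nil => simp [diffListCoeff]
  | cons l ls ih =>
    rw [diffListCoeff_cons, List.length_cons, pow_succ, mul_assoc]
    refine (ih fun l hl => h l (List.mem_cons_of_mem _ hl)).trans ?_
    gcongr
    exact h l List.mem_cons_self _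

lemma expSup_diffListCoeff_replicate_le {S : Finset ℝ} {a e : ℝ} (he : 0 ≤ e)
    (h : ∀ c : ℝ → 𝕜, expSup S (diffCoeff a 0 c) ≤ e * expSup S c) (m : ℕ) (c : ℝ → 𝕜) :
    expSup S (diffListCoeff a (List.replicate m 0) c) ≤ e ^ m * expSup S c := by
  induction m with
  | zero => simp [diffListCoeff]
  | succ m ih =>
    rw [List.replicate_succ, diffListCoeff_cons, pow_succ', mul_assoc]
    refine (h _).trans ?_
    gcongr

lemma diffListCoeff_append (a : ℝ) (l₁ l₂ : List ℝ) (c : ℝ → 𝕜) :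
    diffListCoeff a (l₁ ++ l₂) c = diffListCoeff a l₁ (diffListCoeff a l₂ c) := by
  simp [diffListCoeff]

/-- Each factor is a combination of the identity and the translation by `X` to the right, so it
enlarges the window only at its right end. The left end, which must stay away from `0`, does not
move. -/
lemma integral_diffListCoeff_le (S : Finset ℝ) {X L : ℝ} (hX : 0 ≤ X)
    (hL : 0 < L) (ls : List ℝ) (hls : ∀ l ∈ ls, l ≤ L) (c : ℝ → 𝕜) {u v : ℝ} (huv : u ≤ v) :
    ∫ x in u..v, ‖expSum S (diffListCoeff (X / L) ls c) (x / L)‖ ≤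
      (1 + Real.exp X) ^ ls.length *
        ∫ x in u..(v + ls.length * X), ‖expSum S c (x / L)‖ := by
  have hcont : ∀ c : ℝ → 𝕜, Continuous fun x : ℝ => ‖expSum S c (x / L)‖ := fun c =>
    ((continuous_expSum S c).comp (continuous_id.div_const L)).norm
  induction ls generalizing v with
  | nil => simp [diffListCoeff]
  | cons l ls ih =>
    rw [diffListCoeff_cons, List.length_cons, pow_succ', mul_assoc]
    set d := diffListCoeff (X / L) ls c with hd
    have h2 : Real.exp (l * (X / L)) ≤ Real.exp X := by
      refine Real.exp_le_exp.2 ?_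
      calc l * (X / L) ≤ L * (X / L) := by
            gcongr; exact hls l List.mem_cons_self
        _ = X := by field_simp
    have hcont' : Continuous fun x : ℝ => Real.exp X * ‖expSum S d ((x + X) / L)‖ :=
      ((hcont d).comp (continuous_add_const X)).const_mul (Real.exp X)
    have h3 : ∫ x in u..v, ‖expSum S (diffCoeff (X / L) l d) (x / L)‖ ≤
        ∫ x in u..v, (‖expSum S d (x / L)‖ + Real.exp X * ‖expSum S d ((x + X) / L)‖) := by
      refine intervalIntegral.integral_mono_on huv ((hcont _).intervalIntegrable _ _)
        (((hcont d).add hcont').intervalIntegrable _ _) fun x _ => ?_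
      rw [expSum_diffCoeff, add_div]
      refine (norm_sub_le _ _).trans ?_
      rw [norm_mul, RCLike.norm_ofReal, abs_of_pos (Real.exp_pos _)]
      gcongr
    have h4 : ∫ x in u..v, (‖expSum S d (x / L)‖ + Real.exp X * ‖expSum S d ((x + X) / L)‖) =
        (∫ x in u..v, ‖expSum S d (x / L)‖) +
          Real.exp X * ∫ x in (u + X)..(v + X), ‖expSum S d (x / L)‖ := by
      rw [intervalIntegral.integral_add ((hcont d).intervalIntegrable _ _)
        (hcont'.intervalIntegrable _ _), intervalIntegral.integral_const_mul,
        intervalIntegral.integral_comp_add_right (fun x => ‖expSum S d (x / L)‖)]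
    have h5 : ∀ u' v', u ≤ u' → u' ≤ v' → v' ≤ v + X →
        ∫ x in u'..v', ‖expSum S d (x / L)‖ ≤ ∫ x in u..(v + X), ‖expSum S d (x / L)‖ :=
      fun u' v' h1 h2 h3 => intervalIntegral.integral_mono_interval h1 h2 h3
        (Eventually.of_forall fun x => norm_nonneg _) ((hcont d).intervalIntegrable _ _)
    have h6 := ih (fun l hl => hls l (List.mem_cons_of_mem _ hl)) (v := v + X) (by linarith)
    have h7 : v + ((ls.length + 1 : ℕ) : ℝ) * X = v + X + ls.length * X := by push_cast; ring
    rw [h7]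
    refine (h3.trans_eq h4).trans ?_
    have h8 := h5 u v le_rfl huv (by linarith)
    have h9 := h5 (u + X) (v + X) (by linarith) (by linarith) le_rfl
    calc _ ≤ (1 + Real.exp X) * ∫ x in u..(v + X), ‖expSum S d (x / L)‖ := by
          rw [add_mul, one_mul]; gcongr
      _ ≤ _ := by gcongr

end ExpSup

/-! ### Cluster systems: isolating one cluster from the whole sum. -/

/-- Finite sets of exponents, of bounded size and contained in successive intervals `[L j, B j]` of
bounded ratio that are separated by a fixed ratio `ρ`. -/
structure IsClusterSystem (D : ℕ) (Q ρ : ℝ) (S : ℕ → Finset ℝ) (L B : ℕ → ℝ) : Prop where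
  pos : ∀ j, 0 < L j
  mem : ∀ j, ∀ z ∈ S j, L j ≤ z ∧ z ≤ B j
  le : ∀ j, L j ≤ B j
  le_mul : ∀ j, B j ≤ Q * L j
  mul_le : ∀ j, ρ * B j ≤ L (j + 1)
  card_le : ∀ j, (S j).card ≤ D

namespace IsClusterSystem

variable {D : ℕ} {Q ρ : ℝ} {S : ℕ → Finset ℝ} {L B : ℕ → ℝ}

lemma exponent_pos (h : IsClusterSystem D Q ρ S L B) {j : ℕ} : ∀ z ∈ S j, 0 < z :=
  fun z hz => (h.pos j).trans_le (h.mem j z hz).1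

lemma B_pos (h : IsClusterSystem D Q ρ S L B) (j : ℕ) : 0 < B j := (h.pos j).trans_le (h.le j)

lemma pow_mul_le (h : IsClusterSystem D Q ρ S L B) (hρ : 1 < ρ) {i j : ℕ} (hij : i < j) :
    ρ ^ (j - i) * B i ≤ L j := by
  obtain ⟨k, rfl⟩ := Nat.exists_eq_add_of_lt hij
  have e : i + k + 1 - i = k + 1 := by omega
  rw [e]
  clear hij e
  induction k with
  | zero => simpa using h.mul_le i
  | succ k ih =>
    have h1 := h.mul_le (i + k + 1)
    have h2 := h.le (i + k + 1)
    have h3 : i + (k + 1) + 1 = i + k + 1 + 1 := by ring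
    rw [h3, pow_succ' ρ (k + 1), mul_assoc]
    refine le_trans ?_ h1
    have : 0 < ρ := by linarith
    gcongr
    linarith

lemma pow_mul_L_le (h : IsClusterSystem D Q ρ S L B) (hρ : 1 < ρ) {i j : ℕ} (hij : i ≤ j) :
    ρ ^ (j - i) * L i ≤ L j := by
  rcases hij.eq_or_lt with rfl | hij
  · simp
  · refine le_trans ?_ (h.pow_mul_le hρ hij)
    have : 0 < ρ := by linarith
    gcongr
    exact h.le i

lemma L_mono (h : IsClusterSystem D Q ρ S L B) (hρ : 1 < ρ) {i j : ℕ} (hij : i ≤ j) :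
    L i ≤ L j :=
  le_trans (le_mul_of_one_le_left (h.pos i).le (one_le_pow₀ hρ.le)) (h.pow_mul_L_le hρ hij)

lemma B_lt_L (h : IsClusterSystem D Q ρ S L B) (hρ : 1 < ρ) {i j : ℕ} (hij : i < j) :
    B i < L j := by
  refine lt_of_lt_of_le ?_ (h.pow_mul_le hρ hij)
  exact lt_mul_of_one_lt_left (h.B_pos i) (one_lt_pow₀ hρ (by omega))

lemma disjoint (h : IsClusterSystem D Q ρ S L B) (hρ : 1 < ρ) {i j : ℕ} (hij : i ≠ j) :
    Disjoint (S i) (S j) := by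
  rw [Finset.disjoint_left]
  intro z hi hj
  have h1 := h.mem i z hi
  have h2 := h.mem j z hj
  rcases lt_or_gt_of_ne hij with hij | hij
  · linarith [h.B_lt_L hρ hij]
  · linarith [h.B_lt_L hρ hij]

lemma expSum_biUnion {𝕜 : Type*} [RCLike 𝕜] (h : IsClusterSystem D Q ρ S L B) (hρ : 1 < ρ)
    (J : ℕ) (c : ℝ → 𝕜) (y : ℝ) :
    expSum ((Finset.range J).biUnion S) c y = ∑ j ∈ Finset.range J, expSum (S j) c y :=
  Finset.sum_biUnion fun _ _ _ _ hij => h.disjoint hρ hij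

/-- The weight with which the cluster `i` enters the estimate of the cluster `j`. -/
noncomputable def offDiag (P a k ρ : ℝ) (L : ℕ → ℝ) (m : ℕ) (K : ℝ) (i j : ℕ) : ℝ :=
  if j < i then P ^ m * Real.exp (-(a * K * (L i / L j)))
  else if i + m < j then P ^ m * Real.exp (k * K) * ((ρ ^ (j - i))⁻¹) ^ m else 0

/-- The operators isolating the cluster `j` are `m` plain differences, one annihilating difference
for each exponent of the `m` clusters just below `j`, and a translation by `K / L j`. The first
group suppresses the far lower clusters, the second removes the near lower ones (the value `0` of
`offDiag`), the third suppresses the higher ones. `M`, `P`, `a` and `k` do not depend on `m` and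
`K`, which leaves these two free to be chosen afterwards. -/
theorem expSup_le_integral_add_sum (𝕜 : Type*) [RCLike 𝕜] (D : ℕ) {Q κ : ℝ} (hQ : 1 ≤ Q)
    (hκ : 1 < κ) :
    ∃ M P a k : ℝ, 0 < M ∧ 1 ≤ P ∧ 0 < a ∧ 0 < k ∧ ∀ (m : ℕ) (K : ℝ), 0 ≤ K →
      ∃ C K' : ℝ, 0 < C ∧ K < K' ∧ ∀ (S : ℕ → Finset ℝ) (L B : ℕ → ℝ),
        IsClusterSystem D Q (κ ^ 3) S L B → ∀ (J : ℕ) (c : ℝ → 𝕜), ∀ j < J,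
          expSup (S j) c ≤
            C * (∫ x in K..K', ‖expSum ((Finset.range J).biUnion S) c (x / L j)‖) +
            M * ∑ i ∈ (Finset.range J).erase j,
              offDiag P a k (κ ^ 3) L m K i j * expSup (S i) c := by
  have hκ0 : 0 < κ := by linarith
  have hρ : 1 < κ ^ 3 := one_lt_pow₀ hκ (by norm_num)
  obtain ⟨X, hX, hlow⟩ := expSup_le_diffCoeff 𝕜 (τ := (κ ^ 3)⁻¹) (by positivity)
    (inv_lt_one_of_one_lt₀ hρ) D
  obtain ⟨Cb, hCb, hbern⟩ := expSup_diffCoeff_zero_le 𝕜 D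
  obtain ⟨Cd, hCd, hdecay⟩ := expSup_shiftCoeff_le 𝕜 (θ := κ⁻¹) (by positivity)
    (inv_lt_one_of_one_lt₀ hκ) D
  obtain ⟨Cr, hCr, hgrow⟩ := expSup_le_shiftCoeff 𝕜 hκ D
  obtain ⟨C₁, Y, hC₁, hY, hint⟩ := expSup_le_integral 𝕜 hQ D
  set E := 1 + Real.exp X with hE
  have hE1 : 1 ≤ E := by have := Real.exp_pos X; linarith
  have hCbX : 1 ≤ Cb * X := by nlinarith
  have hκ2 : (κ ^ 2)⁻¹ < κ⁻¹ := by
    rw [inv_lt_inv₀ (by positivity) hκ0]; nlinarith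
  refine ⟨Cr * C₁ * Y * Cd, (2 * E) ^ (D + 1) * (Cb * X), κ⁻¹ - (κ ^ 2)⁻¹, κ * Q, by positivity,
    one_le_mul_of_one_le_of_one_le (one_le_pow₀ (by linarith)) hCbX, by linarith, by positivity,
    fun m K hK => ?_⟩
  -- At most `m + m D` difference operators are applied.
  set T := m * (D + 1) with hT
  refine ⟨2 ^ T * (Cr * Real.exp (κ * Q * K)) * C₁ * E ^ T, K + Y + T * X, by positivity,
    by have : 0 ≤ (T : ℝ) * X := by positivity
       linarith, fun S L B h J c j hj => ?_⟩
  have hLj := h.pos j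
  set near := (Finset.Ico (j - m) j).biUnion S with hnear
  set ls := List.replicate m 0 ++ near.toList with hls
  have hnearcard : near.card ≤ m * D := by
    refine (Finset.card_biUnion_le_card_mul _ _ D fun i _ => h.card_le i).trans ?_
    gcongr
    rw [Nat.card_Ico]; omega
  have hlen : ls.length ≤ T := by
    rw [hls, List.length_append, List.length_replicate, Finset.length_toList, hT, mul_add]
    omega
  have hnearle : ∀ l ∈ near, l ≤ (κ ^ 3)⁻¹ * L j := by
    intro l hl
    obtain ⟨i, hi, hli⟩ := Finset.mem_biUnion.1 hl
    have hij : i < j := (Finset.mem_Ico.1 hi).2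
    rw [le_inv_mul_iff₀ (by positivity)]
    have h1 := h.pow_mul_le hρ hij
    refine le_trans ?_ h1
    have h2 := (h.mem i l hli).2
    have h3 : (κ ^ 3) ≤ (κ ^ 3) ^ (j - i) := le_self_pow₀ hρ.le (by omega)
    have h4 : 0 < l := h.exponent_pos l hli
    gcongr
  have hlsle : ∀ l ∈ ls, l ≤ (κ ^ 3)⁻¹ * L j := by
    intro l hl
    rcases List.mem_append.1 hl with hl | hl
    · rw [(List.mem_replicate.1 hl).2]; positivity
    · exact hnearle l (Finset.mem_toList.1 hl)
  have hlsL : ∀ l ∈ ls, l ≤ L j := fun l hl => (hlsle l hl).trans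
    (mul_le_of_le_one_left hLj.le (inv_le_one_of_one_le₀ hρ.le))
  set d := diffListCoeff (X / L j) ls c with hd
  set c' := shiftCoeff (K / L j) d with hc'
  have hKL : 0 ≤ K / L j := by positivity
  set U := (Finset.range J).biUnion S with hU
  have hmono : ∀ x : ℝ, 1 ≤ x → x ^ ls.length ≤ x ^ T := fun x hx => pow_le_pow_right₀ hx hlen
  -- the cluster `j` is bounded from below
  have h1 : expSup (S j) c ≤
      2 ^ T * (Cr * Real.exp (κ * B j * (K / L j)) * expSup (S j) c') := by
    refine (expSup_le_diffListCoeff (a := X / L j) (ls := ls)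
      (fun l hl c => hlow (S j) c (L j) l (h.card_le j) hLj (fun z hz => (h.mem j z hz).1)
        (hlsle l hl)) c).trans ?_
    have h2 := hgrow (S j) d (B j) (K / L j) (h.card_le j) (h.B_pos j)
      (fun z hz => ⟨h.exponent_pos z hz, (h.mem j z hz).2⟩) hKL
    exact mul_le_mul (hmono 2 (by norm_num)) h2 (expSup_nonneg _ _) (by positivity)
  have hcontU : Continuous fun x : ℝ => ‖expSum U c' (x / L j)‖ :=
    ((continuous_expSum U c').comp (continuous_id.div_const _)).norm
  have hcontS : Continuous fun x : ℝ => ‖expSum (S j) c' (x / L j)‖ :=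
    ((continuous_expSum (S j) c').comp (continuous_id.div_const _)).norm
  set R := ∑ i ∈ (Finset.range J).erase j, expSup (S i) c' with hR
  -- The local `L^1` norm of the cluster is that of the whole sum minus the other clusters, whose
  -- total is at most `R` pointwise.
  have h2 : expSup (S j) c' ≤ C₁ * ((∫ x in (0 : ℝ)..Y, ‖expSum U c' (x / L j)‖) + Y * R) := by
    refine (hint (S j) c' (L j) (h.card_le j) hLj
      (fun z hz => ⟨(h.mem j z hz).1, (h.mem j z hz).2.trans (h.le_mul j)⟩)).trans ?_
    gcongr
    have e1 : ∫ x in (0 : ℝ)..Y, ‖expSum (S j) c' (x / L j)‖ ≤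
        ∫ x in (0 : ℝ)..Y, (‖expSum U c' (x / L j)‖ + R) := by
      refine intervalIntegral.integral_mono_on hY.le (hcontS.intervalIntegrable _ _)
        ((hcontU.add continuous_const).intervalIntegrable _ _) fun x hx => ?_
      have e2 := h.expSum_biUnion hρ J c' (x / L j)
      rw [← Finset.add_sum_erase _ _ (Finset.mem_range.2 hj)] at e2
      have e3 : expSum (S j) c' (x / L j) = expSum U c' (x / L j) -
          ∑ i ∈ (Finset.range J).erase j, expSum (S i) c' (x / L j) := by
        rw [e2]; ring
      rw [e3]
      refine (norm_sub_le _ _).trans ?_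
      gcongr
      refine (norm_sum_le _ _).trans (Finset.sum_le_sum fun i _ => ?_)
      exact norm_expSum_le_expSup h.exponent_pos _ (div_nonneg hx.1 hLj.le)
    refine e1.trans_eq ?_
    rw [intervalIntegral.integral_add (hcontU.intervalIntegrable _ _) (by simp),
      intervalIntegral.integral_const, sub_zero, smul_eq_mul]
  have h3 : ∫ x in (0 : ℝ)..Y, ‖expSum U c' (x / L j)‖ ≤
      E ^ T * ∫ x in K..(K + Y + T * X), ‖expSum U c (x / L j)‖ := by
    have e1 : ∫ x in (0 : ℝ)..Y, ‖expSum U c' (x / L j)‖ =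
        ∫ x in K..(K + Y), ‖expSum U d (x / L j)‖ := by
      have := intervalIntegral.integral_comp_add_right (a := 0) (b := Y)
        (fun x => ‖expSum U d (x / L j)‖) K
      rw [zero_add, add_comm Y K] at this
      rw [← this]
      simp only [hc', expSum_shiftCoeff, add_div]
    rw [e1]
    refine (integral_diffListCoeff_le U (by linarith) hLj ls hlsL c (by linarith)).trans ?_
    have hcont : Continuous fun x : ℝ => ‖expSum U c (x / L j)‖ :=
      ((continuous_expSum U c).comp (continuous_id.div_const _)).norm
    have hlen' : (ls.length : ℝ) ≤ T := by exact_mod_cast hlen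
    have hl0 : 0 ≤ (ls.length : ℝ) * X := by positivity
    refine mul_le_mul (hmono E hE1) ?_ (intervalIntegral.integral_nonneg (by linarith)
      fun x _ => norm_nonneg _) (by positivity)
    exact intervalIntegral.integral_mono_interval le_rfl (by linarith) (by gcongr)
      (Eventually.of_forall fun x => norm_nonneg _) (hcont.intervalIntegrable _ _)
  -- the other clusters
  have hdle : ∀ i, expSup (S i) d ≤ E ^ T * expSup (S i) c := fun i =>
    (expSup_diffListCoeff_le h.exponent_pos (by linarith) hLj ls hlsL c).trans
      (mul_le_mul_of_nonneg_right (hmono E hE1) (expSup_nonneg _ _))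
  have h4 : ∀ i ∈ (Finset.range J).erase j,
      2 ^ T * Real.exp (κ * B j * (K / L j)) * expSup (S i) c' ≤ Cd *
        (offDiag ((2 * E) ^ (D + 1) * (Cb * X)) (κ⁻¹ - (κ ^ 2)⁻¹) (κ * Q) (κ ^ 3) L m K i j *
          expSup (S i) c) := by
    intro i hi
    have hij : i ≠ j := (Finset.mem_erase.1 hi).1
    have hPm : ((2 * E) ^ (D + 1) * (Cb * X)) ^ m = 2 ^ T * E ^ T * (Cb * X) ^ m := by
      rw [mul_pow, ← pow_mul, mul_pow, hT, mul_comm m]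
    have hshift := hdecay (S i) d (L i) (K / L j) (h.card_le i) (h.pos i)
      (fun z hz => (h.mem i z hz).1) hKL
    have hb := expSup_nonneg (S i) c
    have hb' := expSup_nonneg (S i) d
    have hb'' := expSup_nonneg (S i) c'
    rw [offDiag]
    split_ifs with h5 h6
    · have e1 : Real.exp (κ * B j * (K / L j)) * Real.exp (-(κ⁻¹ * L i) * (K / L j)) ≤
          Real.exp (-((κ⁻¹ - (κ ^ 2)⁻¹) * K * (L i / L j))) := by
        rw [← Real.exp_add]
        refine Real.exp_le_exp.2 ?_
        -- This fixes the gap at `κ ^ 3`: one `κ` is lost to the growth of the cluster `j`, one to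
        -- the decay of the cluster `i`, and the third leaves the positive rate `κ⁻¹ - (κ ^ 2)⁻¹`.
        have e2 : κ * B j ≤ (κ ^ 2)⁻¹ * L i := by
          rw [le_inv_mul_iff₀ (by positivity)]
          have e3 := h.pow_mul_le hρ h5
          have e4 : (κ ^ 3) ≤ (κ ^ 3) ^ (i - j) := le_self_pow₀ hρ.le (by omega)
          have e5 := mul_le_mul_of_nonneg_right e4 (h.B_pos j).le
          calc _ = κ ^ 3 * B j := by ring
            _ ≤ _ := e5.trans e3
        have e6 := mul_le_mul_of_nonneg_right e2 hKL
        have e7 : (κ⁻¹ - (κ ^ 2)⁻¹) * K * (L i / L j) =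
          κ⁻¹ * L i * (K / L j) - (κ ^ 2)⁻¹ * L i * (K / L j) := by ring
        linarith
      calc _ ≤ 2 ^ T * Real.exp (κ * B j * (K / L j)) *
            (Cd * Real.exp (-(κ⁻¹ * L i) * (K / L j)) * (E ^ T * expSup (S i) c)) := by
            gcongr
            exact hshift.trans (by gcongr; exact hdle i)
        _ = Cd * (2 ^ T * E ^ T * 1 * (Real.exp (κ * B j * (K / L j)) *
            Real.exp (-(κ⁻¹ * L i) * (K / L j))) * expSup (S i) c) := by ring
        _ ≤ _ := by
            rw [hPm]
            gcongr
            exact one_le_pow₀ hCbX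
    · have e1 : Real.exp (κ * B j * (K / L j)) ≤ Real.exp (κ * Q * K) := by
        refine Real.exp_le_exp.2 ?_
        calc _ ≤ κ * (Q * L j) * (K / L j) := by gcongr; exact h.le_mul j
          _ = _ := by field_simp
      have e2 : expSup (S i) c' ≤ Cd * expSup (S i) d := by
        refine hshift.trans ?_
        have : Real.exp (-(κ⁻¹ * L i) * (K / L j)) ≤ 1 := by
          refine Real.exp_le_one_iff.2 ?_
          have := h.pos i
          have : 0 ≤ κ⁻¹ * L i * (K / L j) := by positivity
          linarith
        calc _ ≤ Cd * 1 * expSup (S i) d := by gcongr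
          _ = _ := by ring
      have e3 : expSup (S i) d ≤
          (Cb * X * ((κ ^ 3) ^ (j - i))⁻¹) ^ m * (E ^ T * expSup (S i) c) := by
        rw [hd, hls, diffListCoeff_append]
        have hlsn : ∀ l ∈ near.toList, l ≤ L j := fun l hl =>
          hlsL l (List.mem_append_right _ hl)
        have hlenn : near.toList.length ≤ T := by
          rw [hls, List.length_append] at hlen; omega
        refine (expSup_diffListCoeff_replicate_le (S := S i) (a := X / L j)
          (e := Cb * X * ((κ ^ 3) ^ (j - i))⁻¹) (by positivity) (fun c => ?_) m _).trans ?_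
        · refine (hbern (S i) c (B i) (X / L j) (h.card_le i)
            (fun z hz => ⟨h.exponent_pos z hz, (h.mem i z hz).2⟩) (h.B_pos i).le
            (by positivity)).trans ?_
          have e4 := h.pow_mul_le hρ (show i < j by omega)
          have e5 : B i ≤ ((κ ^ 3) ^ (j - i))⁻¹ * L j := by
            rwa [le_inv_mul_iff₀ (by positivity)]
          have := expSup_nonneg (S i) c
          calc _ ≤ Cb * (((κ ^ 3) ^ (j - i))⁻¹ * L j * (X / L j)) * expSup (S i) c := by gcongr
            _ = _ := by field_simp
        · gcongr
          exact (expSup_diffListCoeff_le h.exponent_pos (by linarith) hLj _ hlsn c).trans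
            (mul_le_mul_of_nonneg_right (pow_le_pow_right₀ hE1 hlenn) hb)
      calc _ ≤ 2 ^ T * Real.exp (κ * Q * K) *
            (Cd * ((Cb * X * ((κ ^ 3) ^ (j - i))⁻¹) ^ m * (E ^ T * expSup (S i) c))) := by
            gcongr
            exact e2.trans (by gcongr)
        _ = _ := by rw [hPm, mul_pow]; ring
    · have : expSup (S i) c' = 0 := by
        refine expSup_eq_zero fun z hz => ?_
        have : z ∈ ls := List.mem_append_right _ (Finset.mem_toList.2
          (Finset.mem_biUnion.2 ⟨i, Finset.mem_Ico.2 (by omega), hz⟩))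
        rw [hc', shiftCoeff, hd, diffListCoeff_eq_zero this, mul_zero]
      rw [this]
      simp
  have h5 : Real.exp (κ * B j * (K / L j)) ≤ Real.exp (κ * Q * K) := by
    refine Real.exp_le_exp.2 ?_
    calc _ ≤ κ * (Q * L j) * (K / L j) := by gcongr; exact h.le_mul j
      _ = _ := by field_simp
  have hI0 : 0 ≤ ∫ x in K..(K + Y + T * X), ‖expSum U c (x / L j)‖ :=
    intervalIntegral.integral_nonneg (by have : 0 ≤ (T : ℝ) * X := by positivity
                                         linarith) fun x _ => norm_nonneg _
  calc expSup (S j) c ≤ 2 ^ T * (Cr * Real.exp (κ * B j * (K / L j)) *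
        (C₁ * (E ^ T * (∫ x in K..(K + Y + T * X), ‖expSum U c (x / L j)‖) + Y * R))) := by
        refine h1.trans ?_
        gcongr
        refine h2.trans ?_
        gcongr
    _ = 2 ^ T * (Cr * Real.exp (κ * B j * (K / L j))) * C₁ * E ^ T *
          (∫ x in K..(K + Y + T * X), ‖expSum U c (x / L j)‖) +
        Cr * C₁ * Y * ∑ i ∈ (Finset.range J).erase j,
          2 ^ T * Real.exp (κ * B j * (K / L j)) * expSup (S i) c' := by
        rw [← Finset.mul_sum, ← hR]; ring
    _ ≤ _ := by
        rw [mul_assoc (Cr * C₁ * Y) Cd, Finset.mul_sum _ _ Cd]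
        exact add_le_add (by gcongr)
          (mul_le_mul_of_nonneg_left (Finset.sum_le_sum h4) (by positivity))

lemma exists_rpow_mul_exp_neg_le (γ : ℝ) {a : ℝ} (ha : 0 < a) :
    ∃ C : ℝ, 1 ≤ C ∧ ∀ x : ℝ, 1 ≤ x → x ^ γ * Real.exp (-(a * x)) ≤ C * x⁻¹ := by
  obtain ⟨N, hN⟩ := exists_nat_ge (γ + 1)
  refine ⟨max 1 (N.factorial / a ^ N), le_max_left _ _, fun x hx => ?_⟩
  have hx0 : 0 < x := by linarith
  have h1 := Real.pow_div_factorial_le_exp (a * x) (by positivity) N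
  have hf : (0 : ℝ) < N.factorial := by exact_mod_cast N.factorial_pos
  have h2 : x ^ (γ + 1) ≤ x ^ N := by
    rw [← Real.rpow_natCast]; exact Real.rpow_le_rpow_of_exponent_le hx hN
  rw [Real.rpow_add hx0, Real.rpow_one] at h2
  have h3 : x ^ γ * x ≤ N.factorial / a ^ N * Real.exp (a * x) := by
    rw [mul_pow, div_le_iff₀ hf] at h1
    rw [div_mul_eq_mul_div, le_div_iff₀ (by positivity)]
    calc x ^ γ * x * a ^ N ≤ x ^ N * a ^ N := by gcongr
      _ ≤ _ := by linarith
  rw [Real.exp_neg, ← div_eq_mul_inv, ← div_eq_mul_inv, div_le_div_iff₀ (Real.exp_pos _) hx0]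
  exact h3.trans (by gcongr; exact le_max_right _ _)

/-- Each normalized cluster norm is controlled by a local integral of the whole sum, up to a small
multiple of the other cluster norms. -/
theorem expSup_almost_diagonal (𝕜 : Type*) [RCLike 𝕜] (D : ℕ) {Q κ : ℝ} (hQ : 1 ≤ Q)
    (hκ : 1 < κ) {γ η : ℝ} (hγ : 0 ≤ γ) (hη : 0 < η) :
    ∃ C K K' : ℝ, 0 < C ∧ 0 < K ∧ K < K' ∧ ∀ (S : ℕ → Finset ℝ) (L B : ℕ → ℝ),
      IsClusterSystem D Q (κ ^ 3) S L B → ∀ (J : ℕ) (c : ℝ → 𝕜), ∀ j < J,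
        expSup (S j) c * L j ^ (-γ) ≤
          C * (L j ^ (-γ) * ∫ x in K..K', ‖expSum ((Finset.range J).biUnion S) c (x / L j)‖) +
          η * ∑ i ∈ Finset.range J, κ⁻¹ ^ (Nat.dist i j) * (expSup (S i) c * L i ^ (-γ)) := by
  have hκ0 : 0 < κ := by linarith
  have hρ : 1 < κ ^ 3 := one_lt_pow₀ hκ (by norm_num)
  obtain ⟨M, P, a, k, hM, hP, ha, hk, hmain⟩ := expSup_le_integral_add_sum 𝕜 D hQ hκ
  obtain ⟨G, hG, hGx⟩ := exists_rpow_mul_exp_neg_le γ (half_pos ha)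
  -- The translation is taken to be `K = k₀ m`. First `k₀` is chosen so that the decay of the higher
  -- clusters beats `P ^ m`; this makes the lower clusters pay `e ^ (k k₀ m)`, which is then beaten
  -- by the choice of `m`.
  obtain ⟨k₀, hk₀, hk₀'⟩ : ∃ k₀ : ℝ, 1 ≤ k₀ ∧ P * Real.exp (-(a / 2) * k₀) ≤ 1 / 2 := by
    have hlim : Tendsto (fun X : ℝ => P * Real.exp (-(a / 2) * X)) atTop (nhds (P * 0)) :=
      Tendsto.const_mul _ (Real.tendsto_exp_atBot.comp
        (tendsto_id.const_mul_atTop_of_neg (by linarith)))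
    rw [mul_zero] at hlim
    exact ((eventually_ge_atTop (1 : ℝ)).and
      (hlim.eventually (ge_mem_nhds (show (0 : ℝ) < 1 / 2 by norm_num)))).exists
  set P' := P * Real.exp (k * k₀) with hP'
  have hP'0 : 0 < P' := by positivity
  obtain ⟨m, hm1, hm2, hm3⟩ : ∃ m : ℕ, 1 ≤ m ∧ P' * (κ⁻¹ ^ 2) ^ m ≤ 1 / 2 ∧
      M * G * (1 / 2) ^ m ≤ η := by
    have h1 : Tendsto (fun m : ℕ => P' * (κ⁻¹ ^ 2) ^ m) atTop (nhds (P' * 0)) :=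
      (tendsto_pow_atTop_nhds_zero_of_lt_one (by positivity)
        (pow_lt_one₀ (by positivity) (inv_lt_one_of_one_lt₀ hκ) (by norm_num))).const_mul _
    have h2 : Tendsto (fun m : ℕ => M * G * (1 / 2 : ℝ) ^ m) atTop (nhds (M * G * 0)) :=
      (tendsto_pow_atTop_nhds_zero_of_lt_one (by norm_num) (by norm_num)).const_mul _
    rw [mul_zero] at h1 h2
    exact ((eventually_ge_atTop 1).and ((h1.eventually (ge_mem_nhds (by norm_num))).and
      (h2.eventually (ge_mem_nhds hη)))).exists
  have hm1' : (1 : ℝ) ≤ m := by exact_mod_cast hm1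
  obtain ⟨C, K', hC, hKK', hmain⟩ := hmain m (k₀ * m) (by positivity)
  refine ⟨C, k₀ * m, K', hC, by positivity, hKK', fun S L B h J c j hj => ?_⟩
  have hLj := h.pos j
  have hLγ : 0 < L j ^ (-γ) := Real.rpow_pos_of_pos hLj _
  have h1 := mul_le_mul_of_nonneg_right (hmain S L B h J c j hj) hLγ.le
  refine h1.trans ?_
  rw [add_mul]
  refine add_le_add (by rw [mul_assoc, mul_comm _ (L j ^ (-γ))]) ?_
  -- The factor `(L i / L j) ^ γ` comes from passing from the normalization at `j` to that at `i`.
  -- It is at most 1 for lower clusters and is absorbed by the exponential for higher ones.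
  have key : ∀ i ∈ (Finset.range J).erase j,
      M * offDiag P a k (κ ^ 3) L m (k₀ * m) i j * (L i / L j) ^ γ ≤ η * κ⁻¹ ^ (Nat.dist i j) := by
    intro i hi
    have hij : i ≠ j := (Finset.mem_erase.1 hi).1
    have hLi := h.pos i
    rw [offDiag]
    split_ifs with h2 h3
    · set x := L i / L j with hx
      have hxκ : κ ^ (i - j) ≤ x := by
        rw [hx, le_div_iff₀ hLj]
        refine le_trans ?_ (h.pow_mul_L_le hρ h2.le)
        have : κ ≤ κ ^ 3 := le_self_pow₀ hκ.le (by norm_num)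
        gcongr
      have hx1 : 1 ≤ x := (one_le_pow₀ hκ.le).trans hxκ
      -- Half of the exponent pays for `P ^ m`, the other half for `x ^ γ` and the geometric decay.
      have e1 : Real.exp (-(a * (k₀ * m) * x)) ≤
          Real.exp (-(a / 2) * k₀) ^ m * Real.exp (-(a / 2 * x)) := by
        rw [← Real.exp_nat_mul, ← Real.exp_add]
        refine Real.exp_le_exp.2 ?_
        have e2 : 1 ≤ k₀ * m := one_le_mul_of_one_le_of_one_le hk₀ hm1'
        have e3 : k₀ * m ≤ k₀ * m * x := le_mul_of_one_le_right (by positivity) hx1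
        have e4 : x ≤ k₀ * m * x := le_mul_of_one_le_left (by positivity) e2
        have e5 := mul_le_mul_of_nonneg_left (add_le_add e3 e4) (half_pos ha).le
        linarith
      have e2 : Nat.dist i j = i - j := by rw [Nat.dist]; omega
      rw [e2, inv_pow]
      have hxγ : 0 ≤ x ^ γ := Real.rpow_nonneg (by positivity) _
      calc M * (P ^ m * Real.exp (-(a * (k₀ * m) * x))) * x ^ γ
          ≤ M * (P ^ m * (Real.exp (-(a / 2) * k₀) ^ m * Real.exp (-(a / 2 * x)))) * x ^ γ := by
            gcongr
        _ = M * (P * Real.exp (-(a / 2) * k₀)) ^ m * (x ^ γ * Real.exp (-(a / 2 * x))) := by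
            rw [mul_pow]; ring
        _ ≤ M * (1 / 2) ^ m * (G * x⁻¹) := by
            have := hGx x hx1
            have h0 := Real.exp_pos (-(a / 2) * k₀)
            exact mul_le_mul (by gcongr) this (by positivity) (by positivity)
        _ = M * G * (1 / 2) ^ m * x⁻¹ := by ring
        _ ≤ _ := by gcongr
    · have e1 : (L i / L j) ^ γ ≤ 1 := Real.rpow_le_one (by positivity)
        ((div_le_one hLj).2 (h.L_mono hρ (by omega))) hγ
      have e2 : Nat.dist i j = j - i := by rw [Nat.dist]; omega
      -- Since `j - i > m ≥ 1`, `3 (j - i) m ≥ 2 m ^ 2 + (j - i)`. The quadratic term is needed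
      -- against `P' ^ m`.
      have e3 : (((κ ^ 3) ^ (j - i))⁻¹) ^ m ≤ ((κ⁻¹ ^ 2) ^ m) ^ m * κ⁻¹ ^ (j - i) := by
        rw [← inv_pow, ← inv_pow, ← pow_mul, ← pow_mul, ← pow_mul, ← pow_mul, ← pow_add]
        refine pow_le_pow_of_le_one (by positivity) (inv_le_one_of_one_le₀ hκ.le) ?_
        obtain ⟨e, he⟩ := Nat.exists_eq_add_of_lt h3
        have : j - i = m + e + 1 := by omega
        rw [this]
        nlinarith
      have e4 : Real.exp (k * (k₀ * m)) = Real.exp (k * k₀) ^ m := by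
        rw [← Real.exp_nat_mul]; ring_nf
      rw [e2, e4]
      have hMG : M * (1 / 2) ^ m ≤ M * G * (1 / 2) ^ m := by
        gcongr; exact le_mul_of_one_le_right hM.le hG
      calc _ ≤ M * (P ^ m * Real.exp (k * k₀) ^ m * (((κ⁻¹ ^ 2) ^ m) ^ m * κ⁻¹ ^ (j - i))) * 1 := by
            gcongr
        _ = M * (P' * (κ⁻¹ ^ 2) ^ m) ^ m * κ⁻¹ ^ (j - i) := by
            rw [hP', mul_pow, mul_pow]; ring
        _ ≤ M * (1 / 2) ^ m * κ⁻¹ ^ (j - i) := by gcongr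
        _ ≤ _ := by gcongr; exact hMG.trans hm3
    · rw [mul_zero, zero_mul]; positivity
  rw [Finset.mul_sum, Finset.sum_mul, Finset.mul_sum]
  refine (Finset.sum_le_sum (g := fun i => η * (κ⁻¹ ^ (Nat.dist i j) *
    (expSup (S i) c * L i ^ (-γ)))) fun i hi => ?_).trans
    (Finset.sum_le_sum_of_subset_of_nonneg (Finset.erase_subset _ _) fun i _ _ => ?_)
  · have hLi := h.pos i
    have e1 := mul_le_mul_of_nonneg_right (key i hi)
      (mul_nonneg (expSup_nonneg (S i) c) (Real.rpow_nonneg hLi.le (-γ)))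
    have e2 : (L i / L j) ^ γ * L i ^ (-γ) = L j ^ (-γ) := by
      rw [Real.div_rpow hLi.le hLj.le, Real.rpow_neg hLi.le, Real.rpow_neg hLj.le]
      have := (Real.rpow_pos_of_pos hLi γ).ne'
      field_simp
    calc _ = M * offDiag P a k (κ ^ 3) L m (k₀ * m) i j * expSup (S i) c * L j ^ (-γ) := by ring
      _ = M * offDiag P a k (κ ^ 3) L m (k₀ * m) i j * (L i / L j) ^ γ *
            (expSup (S i) c * L i ^ (-γ)) := by rw [← e2]; ring
      _ ≤ _ := by rw [mul_assoc η] at e1; exact e1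
  · have := expSup_nonneg (S i) c
    have := Real.rpow_nonneg (h.pos i).le (-γ)
    positivity

end IsClusterSystem

/-! ### Absorbing a geometric convolution in `ℓ^s`. -/

lemma sum_pow_le_inv_one_sub {τ : ℝ} (hτ0 : 0 ≤ τ) (hτ : τ < 1) (s : Finset ℕ) (g : ℕ → ℕ)
    (hg : Set.InjOn g s) : ∑ i ∈ s, τ ^ g i ≤ (1 - τ)⁻¹ := by
  rw [← Finset.sum_image (f := fun n => τ ^ n) hg, ← tsum_geometric_of_lt_one hτ0 hτ]
  exact (summable_geometric_of_lt_one hτ0 hτ).sum_le_tsum _ fun i _ => by positivity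

lemma sum_pow_dist_le {τ : ℝ} (hτ0 : 0 ≤ τ) (hτ : τ < 1) (s : Finset ℕ) (j : ℕ) :
    ∑ i ∈ s, τ ^ Nat.dist i j ≤ 2 * (1 - τ)⁻¹ := by
  rw [← Finset.sum_filter_add_sum_filter_not s (· ≤ j), two_mul]
  refine add_le_add (sum_pow_le_inv_one_sub hτ0 hτ _ _ ?_) (sum_pow_le_inv_one_sub hτ0 hτ _ _ ?_)
  · intro a ha b hb hab
    simp only [Finset.coe_filter, Set.mem_ofPred_eq] at ha hb
    simp only [Nat.dist] at hab
    omega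
  · intro a ha b hb hab
    simp only [Finset.coe_filter, Set.mem_ofPred_eq] at ha hb
    simp only [Nat.dist] at hab
    omega

lemma sum_mul_rpow_le {ι : Type*} (t : Finset ι) {s : ℝ} (hs : 1 ≤ s) {w a : ι → ℝ}
    (hw : ∀ i, 0 ≤ w i) (ha : ∀ i, 0 ≤ a i) :
    (∑ i ∈ t, w i * a i) ^ s ≤ (∑ i ∈ t, w i) ^ (s - 1) * ∑ i ∈ t, w i * a i ^ s := by
  have hs0 : 0 < s := by linarith
  have hw' : 0 ≤ ∑ i ∈ t, w i := Finset.sum_nonneg fun i _ => hw i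
  have hwa : 0 ≤ ∑ i ∈ t, w i * a i ^ s :=
    Finset.sum_nonneg fun i _ => mul_nonneg (hw i) (Real.rpow_nonneg (ha i) _)
  have h := Real.rpow_le_rpow (Finset.sum_nonneg fun i _ => mul_nonneg (hw i) (ha i))
    (Real.inner_le_weight_mul_Lp_of_nonneg t hs w a hw ha) hs0.le
  refine h.trans_eq ?_
  rw [Real.mul_rpow (Real.rpow_nonneg hw' _) (Real.rpow_nonneg hwa _), ← Real.rpow_mul hw',
    ← Real.rpow_mul hwa, inv_mul_cancel₀ hs0.ne', Real.rpow_one, sub_mul, one_mul,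
    inv_mul_cancel₀ hs0.ne']

/-- Schur's test: the row and column sums of the kernel `τ ^ |i - j|` are at most `2 / (1 - τ)`;
Hölder uses the rows, and exchanging the sums uses the columns. -/
lemma sum_conv_rpow_le {τ : ℝ} (hτ0 : 0 ≤ τ) (hτ : τ < 1) {s : ℝ} (hs : 1 ≤ s) (J : ℕ) {a : ℕ → ℝ}
    (ha : ∀ i, 0 ≤ a i) :
    ∑ j ∈ Finset.range J, (∑ i ∈ Finset.range J, τ ^ Nat.dist i j * a i) ^ s ≤
      (2 * (1 - τ)⁻¹) ^ s * ∑ i ∈ Finset.range J, a i ^ s := by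
  set T := 2 * (1 - τ)⁻¹ with hT
  have hT0 : 0 < T := by have : 0 < 1 - τ := by linarith
                         positivity
  have has : ∀ i, 0 ≤ a i ^ s := fun i => Real.rpow_nonneg (ha i) s
  calc _ ≤ ∑ j ∈ Finset.range J, T ^ (s - 1) * ∑ i ∈ Finset.range J, τ ^ Nat.dist i j * a i ^ s := by
        refine Finset.sum_le_sum fun j _ => ?_
        refine (sum_mul_rpow_le _ hs (fun i => by positivity) ha).trans ?_
        refine mul_le_mul_of_nonneg_right (Real.rpow_le_rpow
          (Finset.sum_nonneg fun i _ => by positivity) (sum_pow_dist_le hτ0 hτ _ j) (by linarith))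
          (Finset.sum_nonneg fun i _ => mul_nonneg (by positivity) (has i))
    _ = T ^ (s - 1) * ∑ i ∈ Finset.range J, (∑ j ∈ Finset.range J, τ ^ Nat.dist j i) * a i ^ s := by
        rw [← Finset.mul_sum, Finset.sum_comm]
        simp only [Finset.sum_mul, Nat.dist_comm]
    _ ≤ T ^ (s - 1) * ∑ i ∈ Finset.range J, T * a i ^ s := by
        gcongr with i hi
        · exact has i
        · exact sum_pow_dist_le hτ0 hτ _ i
    _ = _ := by
        rw [← Finset.mul_sum, ← mul_assoc]
        nth_rewrite 2 [← Real.rpow_one T]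
        rw [← Real.rpow_add hT0, sub_add_cancel]

lemma add_rpow_le_two_rpow_mul {x y s : ℝ} (hx : 0 ≤ x) (hy : 0 ≤ y) (hs : 0 ≤ s) :
    (x + y) ^ s ≤ 2 ^ s * (x ^ s + y ^ s) := by
  have hxs := Real.rpow_nonneg hx s
  have hys := Real.rpow_nonneg hy s
  have h2 : (0 : ℝ) ≤ 2 ^ s := by positivity
  rcases le_total x y with h | h
  · calc (x + y) ^ s ≤ (2 * y) ^ s := Real.rpow_le_rpow (by positivity) (by linarith) hs
      _ = 2 ^ s * y ^ s := Real.mul_rpow (by norm_num) hy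
      _ ≤ _ := by gcongr; linarith
  · calc (x + y) ^ s ≤ (2 * x) ^ s := Real.rpow_le_rpow (by positivity) (by linarith) hs
      _ = 2 ^ s * x ^ s := Real.mul_rpow (by norm_num) hx
      _ ≤ _ := by gcongr; linarith

/-- Absorption of a small convolution term in `ℓ^s`. -/
lemma sum_rpow_le_of_le_add_conv {τ : ℝ} (hτ0 : 0 ≤ τ) (hτ : τ < 1) {s : ℝ} (hs : 1 ≤ s) (J : ℕ)
    {a u : ℕ → ℝ} (ha : ∀ i, 0 ≤ a i) (hu : ∀ i, 0 ≤ u i)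
    (h : ∀ j < J, a j ≤ u j +
      (1 - τ) / 8 * ∑ i ∈ Finset.range J, τ ^ Nat.dist i j * a i) :
    ∑ j ∈ Finset.range J, a j ^ s ≤ 2 * 2 ^ s * ∑ j ∈ Finset.range J, u j ^ s := by
  have hs0 : 0 ≤ s := by linarith
  have h1 : 0 < 1 - τ := by linarith
  have hc : ∀ j, 0 ≤ ∑ i ∈ Finset.range J, τ ^ Nat.dist i j * a i := fun j =>
    Finset.sum_nonneg fun i _ => mul_nonneg (by positivity) (ha i)
  have h2 : ∑ j ∈ Finset.range J, a j ^ s ≤ 2 ^ s * ∑ j ∈ Finset.range J, u j ^ s +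
      2 ^ s * (((1 - τ) / 8) ^ s * ((2 * (1 - τ)⁻¹) ^ s * ∑ i ∈ Finset.range J, a i ^ s)) := by
    calc _ ≤ ∑ j ∈ Finset.range J, 2 ^ s * (u j ^ s + ((1 - τ) / 8) ^ s *
          (∑ i ∈ Finset.range J, τ ^ Nat.dist i j * a i) ^ s) := by
          refine Finset.sum_le_sum fun j hj => ?_
          refine (Real.rpow_le_rpow (ha j) (h j (Finset.mem_range.1 hj)) hs0).trans ?_
          rw [← Real.mul_rpow (by positivity) (hc j)]
          exact add_rpow_le_two_rpow_mul (hu j) (mul_nonneg (by positivity) (hc j)) hs0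
      _ = 2 ^ s * ∑ j ∈ Finset.range J, u j ^ s + 2 ^ s * (((1 - τ) / 8) ^ s *
          ∑ j ∈ Finset.range J, (∑ i ∈ Finset.range J, τ ^ Nat.dist i j * a i) ^ s) := by
          rw [← Finset.mul_sum, Finset.sum_add_distrib, ← Finset.mul_sum, mul_add]
      _ ≤ _ := by
          gcongr
          exact sum_conv_rpow_le hτ0 hτ hs J ha
  -- The constants multiply to `2 · (1 - τ) / 8 · 2 / (1 - τ) = 1 / 2`, and `(1 / 2) ^ s ≤ 1 / 2`.
  -- The sums are finite, so the term can be moved to the left.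
  have h3 : (2 : ℝ) ^ s * (((1 - τ) / 8) ^ s * ((2 * (1 - τ)⁻¹) ^ s *
      ∑ i ∈ Finset.range J, a i ^ s)) = (1 / 2) ^ s * ∑ i ∈ Finset.range J, a i ^ s := by
    rw [← mul_assoc, ← mul_assoc, ← Real.mul_rpow (by norm_num) (by positivity),
      ← Real.mul_rpow (by positivity) (by positivity)]
    congr 2
    field_simp
    norm_num
  have h4 : (1 / 2 : ℝ) ^ s ≤ 1 / 2 := by
    have := Real.rpow_le_rpow_of_exponent_ge (x := 1 / 2) (by norm_num) (by norm_num) hs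
    rwa [Real.rpow_one] at this
  have h5 : 0 ≤ ∑ j ∈ Finset.range J, a j ^ s :=
    Finset.sum_nonneg fun i _ => Real.rpow_nonneg (ha i) _
  rw [h3] at h2
  have := mul_le_mul_of_nonneg_right h4 h5
  linarith

/-! ### From local norms to the weighted norm on `[0, 1]`. -/

lemma lintegral_unitInterval (g : ℝ → ℝ≥0∞) : ∫⁻ t : I, g t = ∫⁻ t in Set.Icc (0 : ℝ) 1, g t :=
  (measurePreserving_subtype_coe measurableSet_Icc).lintegral_comp_emb
    (MeasurableEmbedding.subtype_coe measurableSet_Icc) g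

lemma measurable_muntzWeight_density (α : ℝ) :
    Measurable fun x : I => ENNReal.ofReal ((1 - (x : ℝ)) ^ (α - 1)) := by fun_prop

lemma min_rpow_le_rpow {a b x : ℝ} (e : ℝ) (ha : 0 < a) (hx : a ≤ x) (hxb : x ≤ b) :
    min (a ^ e) (b ^ e) ≤ x ^ e := by
  rcases le_total 0 e with h | h
  · exact (min_le_left _ _).trans (Real.rpow_le_rpow ha.le hx h)
  · exact (min_le_right _ _).trans (Real.rpow_le_rpow_of_nonpos (ha.trans_le hx) hxb h)

lemma lintegral_rpow_le_of_Icc {g : ℝ → ℝ≥0∞} (hg : Measurable g) {s : ℝ} (hs : 1 ≤ s) (a b : ℝ) :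
    (∫⁻ x in Set.Icc a b, g x) ^ s ≤
      ENNReal.ofReal (b - a) ^ (s - 1) * ∫⁻ x in Set.Icc a b, g x ^ s := by
  have hs0 : 0 < s := by linarith
  have hsi : s⁻¹ ≤ 1 := inv_le_one_of_one_le₀ hs
  have h := ENNReal.lintegral_mul_norm_pow_le (μ := volume.restrict (Set.Icc a b))
    (f := fun x => g x ^ s) (g := fun _ => 1) (hg.pow_const s).aemeasurable aemeasurable_const
    (p := s⁻¹) (q := 1 - s⁻¹) (by positivity) (by linarith) (by ring)
  simp only [ENNReal.one_rpow, mul_one, ← ENNReal.rpow_mul, mul_inv_cancel₀ hs0.ne',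
    ENNReal.rpow_one, lintegral_const, Measure.restrict_apply_univ, Real.volume_Icc, one_mul] at h
  refine (ENNReal.rpow_le_rpow h hs0.le).trans_eq ?_
  rw [ENNReal.mul_rpow_of_nonneg _ _ hs0.le, ← ENNReal.rpow_mul, ← ENNReal.rpow_mul,
    inv_mul_cancel₀ hs0.ne', ENNReal.rpow_one, sub_mul, one_mul, inv_mul_cancel₀ hs0.ne', mul_comm]

/-- The points `t = e ^ (-y)` of `[0, 1]` with `K ≤ L y ≤ K'`. -/
def expWindow (K K' L : ℝ) : Set I := {t | 0 < (t : ℝ) ∧ -Real.log t * L ∈ Set.Icc K K'}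

lemma measurableSet_expWindow (K K' L : ℝ) : MeasurableSet (expWindow K K' L) := by
  have h1 : MeasurableSet {t : I | 0 < (t : ℝ)} :=
    measurableSet_lt measurable_const measurable_subtype_coe
  have h2 : Measurable fun t : I => -Real.log t * L :=
    ((Real.measurable_log.comp measurable_subtype_coe).neg).mul_const L
  exact h1.inter (h2 measurableSet_Icc)

/-- With `t = e ^ (-x / L)` and `x ∈ [K, K']`, `1 - t` is comparable to `1 / L` and `dt` to `dx /
L`, so the weight contributes `L ^ (-α)`. Hölder on the bounded interval passes from the `L^1` to
the `L^s` norm. -/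
lemma lintegral_window_le {𝕜 : Type*} [RCLike 𝕜] {α s K K' L₀ : ℝ} (hs : 1 ≤ s) (hK : 0 < K)
    (hKK' : K < K') (hL₀ : 0 < L₀) : ∃ C : ℝ, 0 < C ∧ ∀ L, L₀ ≤ L → ∀ (F : ℝ → 𝕜) (f : I → 𝕜),
      Continuous F → Measurable f → (∀ t : I, 0 < (t : ℝ) → f t = F (-Real.log t)) →
      ENNReal.ofReal (L ^ (-α) * (∫ x in K..K', ‖F (x / L)‖) ^ s) ≤ ENNReal.ofReal C *
        ∫⁻ t, (expWindow K K' L).indicator (fun t => ‖f t‖ₑ ^ s) t ∂muntzWeight α := by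
  have hs0 : 0 < s := by linarith
  -- An upper bound for `x / L`, which keeps `t` away from `0`; this is why `L` must be bounded
  -- below.
  set X := K' / L₀ with hX
  have hX0 : 0 < X := by have : 0 < K' := hK.trans hKK'
                         positivity
  -- The minimum covers both signs of `α - 1`.
  set w := min ((K * Real.exp (-X)) ^ (α - 1)) (K' ^ (α - 1)) with hw
  have hw0 : 0 < w := lt_min (Real.rpow_pos_of_pos (by positivity) _)
    (Real.rpow_pos_of_pos (hK.trans hKK') _)
  set e := Real.exp (-X) * w with he
  have he0 : 0 < e := by positivity
  refine ⟨(K' - K) ^ (s - 1) * e⁻¹, mul_pos (Real.rpow_pos_of_pos (by linarith) _) (by positivity),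
    fun L hL F f hF hf hfF => ?_⟩
  have hLpos : 0 < L := hL₀.trans_le hL
  have hFm : Measurable fun x => ‖F (x / L)‖ₑ :=
    (hF.comp (continuous_id.div_const L)).measurable.enorm
  have hFc : Continuous fun x => ‖F (x / L)‖ := (hF.comp (continuous_id.div_const L)).norm
  -- the change of variables
  set φ : ℝ → ℝ := fun x => Real.exp (-x / L) with hφ
  set g₀ : ℝ → ℝ≥0∞ := fun t => ENNReal.ofReal ((1 - t) ^ (α - 1)) * ‖F (-Real.log t)‖ₑ ^ s with hg₀
  have hφlog : ∀ x, -Real.log (φ x) = x / L := fun x => by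
    rw [hφ]; simp only [Real.log_exp]; ring
  have hφinj : Set.InjOn φ (Set.Icc K K') := by
    intro x _ y _ hxy
    have h1 := hφlog x
    rw [hxy, hφlog y] at h1
    field_simp at h1
    exact h1.symm
  have hφderiv : ∀ x ∈ Set.Icc K K', HasDerivWithinAt φ (φ x * (-1 / L)) (Set.Icc K K') x := by
    intro x _
    have := (((hasDerivAt_id x).neg).div_const L).exp
    exact this.hasDerivWithinAt
  have hcv := lintegral_image_eq_lintegral_abs_deriv_mul measurableSet_Icc hφderiv hφinj g₀
  have himage : φ '' Set.Icc K K' ⊆ Set.Icc 0 1 := by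
    rintro _ ⟨x, hx, rfl⟩
    exact ⟨(Real.exp_pos _).le, Real.exp_le_one_iff.2
      (div_nonpos_of_nonpos_of_nonneg (by linarith [hx.1]) hLpos.le)⟩
  have hφm : MeasurableSet (φ '' Set.Icc K K') :=
    (isCompact_Icc.image (by fun_prop)).measurableSet
  have h1 : ∫⁻ t, (expWindow K K' L).indicator (fun t => ‖f t‖ₑ ^ s) t ∂muntzWeight α =
      ∫⁻ x in Set.Icc K K', ENNReal.ofReal |φ x * (-1 / L)| * g₀ (φ x) := by
    rw [← hcv, muntzWeight, lintegral_withDensity_eq_lintegral_mul _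
      (measurable_muntzWeight_density α)
      ((hf.enorm.pow_const s).indicator (measurableSet_expWindow K K' L))]
    have h2 : ∀ t : I, ((fun x : I => ENNReal.ofReal ((1 - (x : ℝ)) ^ (α - 1))) *
        (expWindow K K' L).indicator (fun t => ‖f t‖ₑ ^ s)) t =
        (φ '' Set.Icc K K').indicator g₀ (t : ℝ) := by
      intro t
      have hmem : t ∈ expWindow K K' L ↔ (t : ℝ) ∈ φ '' Set.Icc K K' := by
        constructor
        · rintro ⟨h0, ht⟩
          refine ⟨_, ht, ?_⟩
          simp only [hφ]
          rw [neg_mul, neg_neg, mul_div_cancel_right₀ _ hLpos.ne', Real.exp_log h0]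
        · rintro ⟨x, hx, hxt⟩
          refine ⟨hxt ▸ Real.exp_pos _, ?_⟩
          rw [← hxt, hφlog, div_mul_cancel₀ _ hLpos.ne']
          exact hx
      rw [Pi.mul_apply]
      by_cases ht : t ∈ expWindow K K' L
      · rw [Set.indicator_of_mem ht, Set.indicator_of_mem (hmem.1 ht), hg₀, hfF t ht.1]
      · rw [Set.indicator_of_notMem ht, Set.indicator_of_notMem (fun h => ht (hmem.2 h)), mul_zero]
    rw [lintegral_congr h2, lintegral_unitInterval, lintegral_indicator hφm,
      Measure.restrict_restrict hφm, Set.inter_eq_left.2 himage]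
  have h2 : ∀ x ∈ Set.Icc K K', ENNReal.ofReal (e * L ^ (-α)) * ‖F (x / L)‖ₑ ^ s ≤
      ENNReal.ofReal |φ x * (-1 / L)| * g₀ (φ x) := by
    intro x hx
    simp only [hg₀, hφlog]
    rw [← mul_assoc, ← ENNReal.ofReal_mul (abs_nonneg _)]
    refine mul_le_mul_left (ENNReal.ofReal_le_ofReal ?_) _
    have hxL : x / L ≤ X := by
      rw [hX]
      exact div_le_div₀ (hK.trans hKK').le hx.2 hL₀ hL
    have hx0 : 0 < x / L := div_pos (hK.trans_le hx.1) hLpos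
    have hφx : φ x = Real.exp (-(x / L)) := by rw [hφ]; simp only [neg_div]
    have e1 : Real.exp (-X) ≤ φ x := by rw [hφx]; exact Real.exp_le_exp.2 (by linarith)
    have e2 : 1 - φ x ≤ x / L := by
      have := Real.one_sub_le_exp_neg (x / L); rw [hφx]; linarith
    have e3 : x / L * Real.exp (-X) ≤ 1 - φ x := by
      have e4 : x / L + 1 ≤ Real.exp (x / L) := Real.add_one_le_exp _
      have e5 : φ x * Real.exp (x / L) = 1 := by rw [hφx, ← Real.exp_add]; simp
      have e6 : 0 < φ x := Real.exp_pos _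
      nlinarith
    have e7 : w ≤ (L * (1 - φ x)) ^ (α - 1) := by
      refine min_rpow_le_rpow _ (by positivity) ?_ ?_
      · calc K * Real.exp (-X) ≤ x * Real.exp (-X) := by gcongr; exact hx.1
          _ = L * (x / L * Real.exp (-X)) := by field_simp
          _ ≤ _ := by gcongr
      · calc L * (1 - φ x) ≤ L * (x / L) := by gcongr
          _ = x := by field_simp
          _ ≤ K' := hx.2
    have e8 : 0 ≤ 1 - φ x := le_trans (by positivity) e3
    rw [Real.mul_rpow hLpos.le e8] at e7
    have e9 : |φ x * (-1 / L)| = φ x * L⁻¹ := by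
      rw [abs_mul, abs_of_pos (Real.exp_pos _), abs_div, abs_neg, abs_one, abs_of_pos hLpos,
        one_div]
    have e10 : L ^ (-α) * L ^ (α - 1) = L⁻¹ := by
      rw [← Real.rpow_add hLpos, ← Real.rpow_neg_one]; ring_nf
    have hLα := Real.rpow_pos_of_pos hLpos (-α)
    have e11 := Real.rpow_nonneg e8 (α - 1)
    rw [e9, ← e10, he]
    calc _ ≤ φ x * (L ^ (α - 1) * (1 - φ x) ^ (α - 1)) * L ^ (-α) := by gcongr
      _ = _ := by ring
  have h3 : ENNReal.ofReal (∫ x in K..K', ‖F (x / L)‖) = ∫⁻ x in Set.Icc K K', ‖F (x / L)‖ₑ := by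
    rw [intervalIntegral.integral_of_le hKK'.le, ← integral_Icc_eq_integral_Ioc,
      ofReal_integral_eq_lintegral_ofReal (hFc.integrableOn_Icc)
        (Eventually.of_forall fun x => norm_nonneg _)]
    simp only [ofReal_norm]
  have hI0 : 0 ≤ ∫ x in K..K', ‖F (x / L)‖ :=
    intervalIntegral.integral_nonneg hKK'.le fun x _ => norm_nonneg _
  have hLα := Real.rpow_pos_of_pos hLpos (-α)
  have hKs : (0 : ℝ) ≤ (K' - K) ^ (s - 1) := Real.rpow_nonneg (by linarith) _
  calc ENNReal.ofReal (L ^ (-α) * (∫ x in K..K', ‖F (x / L)‖) ^ s)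
      = ENNReal.ofReal (L ^ (-α)) * (∫⁻ x in Set.Icc K K', ‖F (x / L)‖ₑ) ^ s := by
        rw [ENNReal.ofReal_mul hLα.le, ← ENNReal.ofReal_rpow_of_nonneg hI0 hs0.le, h3]
    _ ≤ ENNReal.ofReal (L ^ (-α)) * (ENNReal.ofReal (K' - K) ^ (s - 1) *
          ∫⁻ x in Set.Icc K K', ‖F (x / L)‖ₑ ^ s) := by
        gcongr
        exact lintegral_rpow_le_of_Icc hFm hs _ _
    _ = ENNReal.ofReal ((K' - K) ^ (s - 1) * e⁻¹) * (ENNReal.ofReal (e * L ^ (-α)) *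
          ∫⁻ x in Set.Icc K K', ‖F (x / L)‖ₑ ^ s) := by
        rw [ENNReal.ofReal_rpow_of_nonneg (by linarith) (by linarith), ← mul_assoc, ← mul_assoc,
          ← ENNReal.ofReal_mul hLα.le, ← ENNReal.ofReal_mul (by positivity)]
        congr 2
        field_simp
    _ = ENNReal.ofReal ((K' - K) ^ (s - 1) * e⁻¹) *
          ∫⁻ x in Set.Icc K K', ENNReal.ofReal (e * L ^ (-α)) * ‖F (x / L)‖ₑ ^ s := by
        rw [lintegral_const_mul _ (hFm.pow_const s)]
    _ ≤ _ := by
        rw [h1]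
        exact mul_le_mul_right (setLIntegral_mono' measurableSet_Icc h2) _

namespace IsClusterSystem

variable {D : ℕ} {Q ρ : ℝ} {S : ℕ → Finset ℝ} {L B : ℕ → ℝ}

/-- If `j₀` is the first window containing `t`, then for `j ≥ j₀ + N` one has `-log t · L j ≥ ρ ^ N
K > K'`, so `t` lies in at most `N` windows. `K > 0` is what makes such an `N` exist. -/
lemma sum_indicator_expWindow_le (h : IsClusterSystem D Q ρ S L B) (hρ : 1 < ρ) {K K' : ℝ}
    (hK : 0 < K) {N : ℕ} (hN : K' < ρ ^ N * K) (J : ℕ) (g : I → ℝ≥0∞) (t : I) :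
    ∑ j ∈ Finset.range J, (expWindow K K' (L j)).indicator g t ≤ N * g t := by
  classical
  simp only [Set.indicator_apply]
  rw [← Finset.sum_filter, Finset.sum_const, nsmul_eq_mul]
  gcongr
  set A := (Finset.range J).filter fun j => t ∈ expWindow K K' (L j) with hA
  rcases A.eq_empty_or_nonempty with h0 | h0
  · simp [h0]
  · set j₀ := A.min' h0 with hj₀
    have hj₀A : t ∈ expWindow K K' (L j₀) := (Finset.mem_filter.1 (A.min'_mem h0)).2
    have : A ⊆ Finset.Ico j₀ (j₀ + N) := by
      intro j hj
      have hle : j₀ ≤ j := A.min'_le j hj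
      have hjA : t ∈ expWindow K K' (L j) := (Finset.mem_filter.1 hj).2
      refine Finset.mem_Ico.2 ⟨hle, ?_⟩
      by_contra hcon
      have h1 := h.pow_mul_L_le hρ hle
      have h2 : ρ ^ N ≤ ρ ^ (j - j₀) := pow_le_pow_right₀ hρ.le (by omega)
      have hy0 := hj₀A.2.1
      have hLj₀ := h.pos j₀
      have hy : 0 ≤ -Real.log t := by
        by_contra hneg
        have := mul_neg_of_neg_of_pos (not_le.1 hneg) hLj₀
        linarith
      have h3 : ρ ^ N * L j₀ ≤ L j := le_trans (by gcongr) h1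
      have h4 := mul_le_mul_of_nonneg_left h3 hy
      have h5 : ρ ^ N * K ≤ ρ ^ N * (-Real.log t * L j₀) :=
        mul_le_mul_of_nonneg_left hy0 (by have : 0 < ρ := by linarith
                                          positivity)
      have h6 := hjA.2.2
      nlinarith
    simpa using Finset.card_le_card this

/-- The `ℓ^s` norm of the normalized cluster norms is controlled by the weighted `L^s` norm. -/
theorem sum_expSup_rpow_le (𝕜 : Type*) [RCLike 𝕜] {κ : ℝ} (hQ : 1 ≤ Q) (hκ : 1 < κ)
    (h : IsClusterSystem D Q (κ ^ 3) S L B) {α s : ℝ} (hα : 0 < α) (hs : 1 ≤ s) :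
    ∃ C : ℝ, 0 < C ∧ ∀ (J : ℕ) (c : ℝ → 𝕜) (f : I → 𝕜), Measurable f →
      (∀ t : I, 0 < (t : ℝ) → f t = expSum ((Finset.range J).biUnion S) c (-Real.log t)) →
      ENNReal.ofReal (∑ j ∈ Finset.range J, (expSup (S j) c * L j ^ (-(α / s))) ^ s) ≤
        ENNReal.ofReal C * ∫⁻ t, ‖f t‖ₑ ^ s ∂muntzWeight α := by
  have hs0 : 0 < s := by linarith
  have hκ0 : 0 < κ := by linarith
  have hρ : 1 < κ ^ 3 := one_lt_pow₀ hκ (by norm_num)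
  have hτ : κ⁻¹ < 1 := inv_lt_one_of_one_lt₀ hκ
  have hτ' : 0 < 1 - κ⁻¹ := by linarith
  -- This `η` is the coefficient required by the absorption lemma with `τ = κ⁻¹`.
  obtain ⟨C, K, K', hC, hK, hKK', hdiag⟩ := expSup_almost_diagonal 𝕜 D hQ hκ (γ := α / s)
    (η := (1 - κ⁻¹) / 8) (by positivity) (by positivity)
  obtain ⟨C', hC', hwin⟩ := lintegral_window_le (𝕜 := 𝕜) (α := α) hs hK hKK' (h.pos 0)
  obtain ⟨N, hN⟩ := pow_unbounded_of_one_lt (K' / K) hρ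
  rw [div_lt_iff₀ hK] at hN
  have hN0 : (0 : ℝ) < N + 1 := by positivity
  refine ⟨2 * 2 ^ s * C ^ s * (C' * (N + 1)), by positivity, fun J c f hf hfc => ?_⟩
  set U := (Finset.range J).biUnion S with hU
  set V : ℕ → ℝ := fun j => ∫ x in K..K', ‖expSum U c (x / L j)‖ with hV
  have hV0 : ∀ j, 0 ≤ V j := fun j =>
    intervalIntegral.integral_nonneg hKK'.le fun x _ => norm_nonneg _
  have hLγ : ∀ j, 0 ≤ L j ^ (-(α / s)) := fun j => Real.rpow_nonneg (h.pos j).le _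
  have h1 := sum_rpow_le_of_le_add_conv (τ := κ⁻¹) (by positivity) hτ hs J
    (a := fun j => expSup (S j) c * L j ^ (-(α / s)))
    (u := fun j => C * (L j ^ (-(α / s)) * V j))
    (fun j => mul_nonneg (expSup_nonneg _ _) (hLγ j))
    (fun j => mul_nonneg hC.le (mul_nonneg (hLγ j) (hV0 j)))
    (fun j hj => hdiag S L B h J c j hj)
  have h2 : ∀ j, (C * (L j ^ (-(α / s)) * V j)) ^ s = C ^ s * (L j ^ (-α) * V j ^ s) := by
    intro j
    rw [Real.mul_rpow hC.le (mul_nonneg (hLγ j) (hV0 j)), Real.mul_rpow (hLγ j) (hV0 j),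
      ← Real.rpow_mul (h.pos j).le]
    congr 4
    field_simp
  simp only [h2] at h1
  rw [← Finset.mul_sum, ← mul_assoc] at h1
  have h3 : ∀ j, 0 ≤ L j ^ (-α) * V j ^ s := fun j =>
    mul_nonneg (Real.rpow_nonneg (h.pos j).le _) (Real.rpow_nonneg (hV0 j) _)
  have h4 : ∑ j ∈ Finset.range J, ENNReal.ofReal (L j ^ (-α) * V j ^ s) ≤
      ENNReal.ofReal C' * ((N : ℝ≥0∞) * ∫⁻ t, ‖f t‖ₑ ^ s ∂muntzWeight α) := by
    calc _ ≤ ∑ j ∈ Finset.range J, ENNReal.ofReal C' *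
          ∫⁻ t, (expWindow K K' (L j)).indicator (fun t => ‖f t‖ₑ ^ s) t ∂muntzWeight α :=
          Finset.sum_le_sum fun j _ => hwin (L j) (h.L_mono hρ (Nat.zero_le j)) _ f
            (continuous_expSum U c) hf hfc
      _ = ENNReal.ofReal C' * ∫⁻ t, ∑ j ∈ Finset.range J,
          (expWindow K K' (L j)).indicator (fun t => ‖f t‖ₑ ^ s) t ∂muntzWeight α := by
          rw [← Finset.mul_sum, lintegral_finsetSum _ fun j _ =>
            (hf.enorm.pow_const s).indicator (measurableSet_expWindow _ _ _)]
      _ ≤ _ := by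
          rw [← lintegral_const_mul _ (hf.enorm.pow_const s)]
          gcongr with t
          exact h.sum_indicator_expWindow_le hρ hK hN J _ t
  calc _ ≤ ENNReal.ofReal (2 * 2 ^ s * C ^ s * ∑ j ∈ Finset.range J, L j ^ (-α) * V j ^ s) :=
        ENNReal.ofReal_le_ofReal h1
    _ = ENNReal.ofReal (2 * 2 ^ s * C ^ s) *
          ∑ j ∈ Finset.range J, ENNReal.ofReal (L j ^ (-α) * V j ^ s) := by
        rw [ENNReal.ofReal_mul (by positivity), ENNReal.ofReal_sum_of_nonneg fun j _ => h3 j]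
    _ ≤ ENNReal.ofReal (2 * 2 ^ s * C ^ s) * (ENNReal.ofReal C' *
          (ENNReal.ofReal (N + 1) * ∫⁻ t, ‖f t‖ₑ ^ s ∂muntzWeight α)) := by
        refine mul_le_mul_right (h4.trans ?_) _
        gcongr
        rw [← ENNReal.ofReal_natCast]
        exact ENNReal.ofReal_le_ofReal (by linarith)
    _ = _ := by
        rw [ENNReal.ofReal_mul (p := 2 * 2 ^ s * C ^ s) (by positivity), ENNReal.ofReal_mul hC'.le]
        ring

end IsClusterSystem

/-! ### The `L^r(μ)` norm of a positive lacunary sum. -/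

/-- Bernoulli's inequality at `S / (S + x) = 1 - x / (S + x)`. -/
lemma add_rpow_le_rpow_add_mul {r S x : ℝ} (hr : 1 ≤ r) (hS : 0 ≤ S) (hx : 0 ≤ x) :
    (S + x) ^ r ≤ S ^ r + r * (x * (S + x) ^ (r - 1)) := by
  rcases (add_nonneg hS hx).eq_or_lt with h0 | h0
  · rw [← h0, Real.zero_rpow (by linarith)]
    have := Real.rpow_nonneg hS r
    have := Real.rpow_nonneg le_rfl (r - 1)
    positivity
  · have h1 := one_add_mul_self_le_rpow_one_add (s := -(x / (S + x)))
      (by rw [neg_le_neg_iff, div_le_one h0]; linarith) hr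
    have h2 : 1 + -(x / (S + x)) = S / (S + x) := by field_simp; ring
    rw [h2, Real.div_rpow hS h0.le, le_div_iff₀ (Real.rpow_pos_of_pos h0 r)] at h1
    have h3 : (S + x) ^ r = (S + x) ^ (r - 1) * (S + x) := by
      nth_rewrite 3 [← Real.rpow_one (S + x)]
      rw [← Real.rpow_add h0, sub_add_cancel]
    have h4 : r * -(x / (S + x)) * (S + x) ^ r = -(r * (x * (S + x) ^ (r - 1))) := by
      rw [h3]; field_simp
    rw [add_mul, one_mul, h4] at h1
    linarith

/-- Telescoping the `r`-th powers of the partial sums. It reduces the power of a sum to products of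
two terms with `j ≤ k`, for non-integer `r` as well. -/
lemma sum_rpow_le_sum_mul_partial {r : ℝ} (hr : 1 ≤ r) {x : ℕ → ℝ} (hx : ∀ j, 0 ≤ x j) (J : ℕ) :
    (∑ j ∈ Finset.range J, x j) ^ r ≤
      r * ∑ k ∈ Finset.range J, x k * (∑ j ∈ Finset.range (k + 1), x j) ^ (r - 1) := by
  induction J with
  | zero => simp [Real.zero_rpow (show r ≠ 0 by linarith)]
  | succ J ih =>
    rw [Finset.sum_range_succ (fun k => x k * (∑ j ∈ Finset.range (k + 1), x j) ^ (r - 1)), mul_add]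
    have := add_rpow_le_rpow_add_mul hr (Finset.sum_nonneg fun j (_ : j ∈ Finset.range J) => hx j)
      (hx J)
    rw [← Finset.sum_range_succ] at this
    linarith

/-- A geometrically weighted replacement of Hölder's inequality, valid for all exponents. -/
lemma sum_rpow_le_geometric {v ω : ℝ} (hv : 0 < v) (hω : 1 < ω) {x : ℕ → ℝ} (hx : ∀ j, 0 ≤ x j)
    (k : ℕ) : (∑ j ∈ Finset.range (k + 1), x j) ^ v ≤ ((1 - ω⁻¹ ^ v⁻¹)⁻¹) ^ v *
      ∑ j ∈ Finset.range (k + 1), ω ^ (k - j) * x j ^ v := by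
  have hω0 : 0 < ω := by linarith
  set Z := ∑ j ∈ Finset.range (k + 1), ω ^ (k - j) * x j ^ v with hZ
  have hterm : ∀ j, 0 ≤ ω ^ (k - j) * x j ^ v := fun j =>
    mul_nonneg (by positivity) (Real.rpow_nonneg (hx j) v)
  have hZ0 : 0 ≤ Z := Finset.sum_nonneg fun j _ => hterm j
  set q := ω⁻¹ ^ v⁻¹ with hq
  have hq0 : 0 < q := Real.rpow_pos_of_pos (by positivity) _
  have hq1 : q < 1 := Real.rpow_lt_one (by positivity) (inv_lt_one_of_one_lt₀ hω) (by positivity)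
  -- Each term is bounded by the whole weighted sum, and the resulting bounds form a geometric
  -- series. No convexity is used, so `v = r - 1 < 1` is allowed.
  have h1 : ∀ j ∈ Finset.range (k + 1), x j ≤ q ^ (k - j) * Z ^ v⁻¹ := by
    intro j hj
    have h2 : ω ^ (k - j) * x j ^ v ≤ Z := Finset.single_le_sum (fun j _ => hterm j) hj
    have h3 : x j ^ v ≤ ω⁻¹ ^ (k - j) * Z := by
      rw [inv_pow, le_inv_mul_iff₀ (by positivity)]; exact h2
    have h4 := Real.rpow_le_rpow (Real.rpow_nonneg (hx j) v) h3 (inv_nonneg.2 hv.le)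
    rw [Real.rpow_rpow_inv (hx j) hv.ne', Real.mul_rpow (by positivity) hZ0] at h4
    refine h4.trans_eq ?_
    rw [hq, ← Real.rpow_natCast, ← Real.rpow_natCast, ← Real.rpow_mul (by positivity),
      ← Real.rpow_mul (by positivity), mul_comm v⁻¹]
  have h2 : ∑ j ∈ Finset.range (k + 1), x j ≤ (1 - q)⁻¹ * Z ^ v⁻¹ := by
    refine (Finset.sum_le_sum h1).trans ?_
    rw [← Finset.sum_mul]
    refine mul_le_mul_of_nonneg_right (sum_pow_le_inv_one_sub hq0.le hq1 _ _ ?_)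
      (Real.rpow_nonneg hZ0 _)
    intro a ha b hb hab
    simp only [Finset.coe_range, Set.mem_Iio] at ha hb hab
    omega
  have h3 := Real.rpow_le_rpow (Finset.sum_nonneg fun j _ => hx j) h2 hv.le
  have h4 : 0 ≤ (1 - q)⁻¹ := inv_nonneg.2 (by linarith)
  rwa [Real.mul_rpow h4 (Real.rpow_nonneg hZ0 _), Real.rpow_inv_rpow hZ0 hv.ne'] at h3

lemma mul_rpow_sub_one_le {a b r : ℝ} (ha : 0 ≤ a) (hb : 0 ≤ b) (hr : 1 < r) :
    a * b ^ (r - 1) ≤ a ^ r + b ^ r := by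
  have har := Real.rpow_nonneg ha r
  have hbr := Real.rpow_nonneg hb r
  have key : ∀ c : ℝ, 0 ≤ c → c * c ^ (r - 1) = c ^ r := by
    intro c hc
    rcases hc.eq_or_lt with rfl | hc
    · simp [Real.zero_rpow (show r ≠ 0 by linarith)]
    · nth_rewrite 1 [← Real.rpow_one c]
      rw [← Real.rpow_add hc]; ring_nf
  rcases le_total a b with h | h
  · calc a * b ^ (r - 1) ≤ b * b ^ (r - 1) := by
          gcongr
      _ = b ^ r := key b hb
      _ ≤ _ := by linarith
  · calc a * b ^ (r - 1) ≤ a * a ^ (r - 1) := by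
          gcongr
      _ = a ^ r := key a ha
      _ ≤ _ := by linarith

/-- Hölder with weights `w = θ / p'` and `1 - w`: `t ^ (θ k)` is the `w`-th power of `t ^ (p' k)`,
and on `[0, 1]` `t ^ (θ l (r - 1))` is at most the `(1 - w)`-th power of `t ^ (p' l)` because `p' ≤
θ r`. As `1 / r < θ / p'`, the remaining power of `l / k` is positive, giving a gain when `l` is
much smaller than `k`. -/
lemma lintegral_mul_mul_rpow_le {μ : Measure I} {A δ θ p' r l k : ℝ} (hA : 0 ≤ A) (hθ : 0 < θ)
    (hθp : θ < p') (hp'r : p' < θ * r) (hr : 1 < r) (hl : 0 < l) (hk : 0 < k)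
    (hμl : ∫⁻ t : I, ENNReal.ofReal ((t : ℝ) ^ (p' * l)) ∂μ ≤ ENNReal.ofReal (A * l ^ (-δ)))
    (hμk : ∫⁻ t : I, ENNReal.ofReal ((t : ℝ) ^ (p' * k)) ∂μ ≤ ENNReal.ofReal (A * k ^ (-δ)))
    {a b : ℝ} (ha : 0 ≤ a) (hb : 0 ≤ b) :
    ∫⁻ t : I, ENNReal.ofReal ((a * k ^ (δ / r) * (t : ℝ) ^ (θ * k)) *
      (b * l ^ (δ / r) * (t : ℝ) ^ (θ * l)) ^ (r - 1)) ∂μ ≤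
      ENNReal.ofReal (A * (a * b ^ (r - 1)) * (l / k) ^ (δ * (θ / p' - 1 / r))) := by
  have hp' : 0 < p' := hθ.trans hθp
  set w := θ / p' with hw
  have hw0 : 0 < w := by positivity
  have hw1 : w < 1 := (div_lt_one hp').2 hθp
  have hl' := Real.rpow_pos_of_pos hl (δ / r)
  have hk' := Real.rpow_pos_of_pos hk (δ / r)
  set c := a * k ^ (δ / r) * (b * l ^ (δ / r)) ^ (r - 1) with hc
  have hblr : 0 ≤ (b * l ^ (δ / r)) ^ (r - 1) := Real.rpow_nonneg (by positivity) _
  have hc0 : 0 ≤ c := by positivity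
  have h1 : ∀ t : I, ENNReal.ofReal ((a * k ^ (δ / r) * (t : ℝ) ^ (θ * k)) *
      (b * l ^ (δ / r) * (t : ℝ) ^ (θ * l)) ^ (r - 1)) ≤ ENNReal.ofReal c *
      (ENNReal.ofReal ((t : ℝ) ^ (p' * k)) ^ w * ENNReal.ofReal ((t : ℝ) ^ (p' * l)) ^ (1 - w)) := by
    intro t
    have ht0 : 0 ≤ (t : ℝ) := t.2.1
    have e1 := Real.rpow_nonneg ht0 (p' * k)
    have e2 := Real.rpow_nonneg ht0 (p' * l)
    rw [ENNReal.ofReal_rpow_of_nonneg e1 hw0.le, ENNReal.ofReal_rpow_of_nonneg e2 (by linarith),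
      ← ENNReal.ofReal_mul (Real.rpow_nonneg e1 _), ← ENNReal.ofReal_mul hc0]
    refine ENNReal.ofReal_le_ofReal ?_
    rw [Real.mul_rpow (by positivity) (Real.rpow_nonneg ht0 _), ← Real.rpow_mul ht0,
      ← Real.rpow_mul ht0, ← Real.rpow_mul ht0]
    have e3 : θ * k = p' * k * w := by rw [hw]; field_simp
    have e4 : (t : ℝ) ^ (θ * l * (r - 1)) ≤ (t : ℝ) ^ (p' * l * (1 - w)) := by
      refine Real.rpow_le_rpow_of_exponent_ge_of_imp ht0 t.2.2 ?_ ?_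
      · have : p' * l * (1 - w) = l * (p' - θ) := by rw [hw]; field_simp
        rw [this]
        have : θ * l * (r - 1) = l * (θ * r - θ) := by ring
        rw [this]
        gcongr
      · intro _ h
        exfalso
        have : 0 < θ * l * (r - 1) := by
          have : 0 < r - 1 := by linarith
          positivity
        linarith
    rw [e3, hc]
    have e5 := Real.rpow_nonneg ht0 (p' * k * w)
    calc _ = a * k ^ (δ / r) * (b * l ^ (δ / r)) ^ (r - 1) *
          ((t : ℝ) ^ (p' * k * w) * (t : ℝ) ^ (θ * l * (r - 1))) := by ring
      _ ≤ _ := by gcongr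
  have hm : ∀ e : ℝ, AEMeasurable (fun t : I => ENNReal.ofReal ((t : ℝ) ^ e)) μ := fun e => by
    fun_prop
  have hlδ := Real.rpow_pos_of_pos hl (-δ)
  have hkδ := Real.rpow_pos_of_pos hk (-δ)
  calc _ ≤ ∫⁻ t : I, ENNReal.ofReal c * (ENNReal.ofReal ((t : ℝ) ^ (p' * k)) ^ w *
        ENNReal.ofReal ((t : ℝ) ^ (p' * l)) ^ (1 - w)) ∂μ := lintegral_mono h1
    _ = ENNReal.ofReal c * ∫⁻ t : I, (ENNReal.ofReal ((t : ℝ) ^ (p' * k)) ^ w *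
        ENNReal.ofReal ((t : ℝ) ^ (p' * l)) ^ (1 - w)) ∂μ :=
        lintegral_const_mul'' _ (((hm _).pow_const _).mul ((hm _).pow_const _))
    _ ≤ ENNReal.ofReal c * (ENNReal.ofReal (A * k ^ (-δ)) ^ w *
        ENNReal.ofReal (A * l ^ (-δ)) ^ (1 - w)) := by
        gcongr
        refine (ENNReal.lintegral_mul_norm_pow_le (hm _) (hm _) hw0.le (by linarith)
          (by ring)).trans ?_
        gcongr
    _ = _ := by
        rw [ENNReal.ofReal_rpow_of_nonneg (by positivity) hw0.le,
          ENNReal.ofReal_rpow_of_nonneg (by positivity) (by linarith),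
          ← ENNReal.ofReal_mul (Real.rpow_nonneg (by positivity) _), ← ENNReal.ofReal_mul hc0]
        congr 1
        rw [hc, Real.mul_rpow hb hl'.le, Real.mul_rpow hA hkδ.le, Real.mul_rpow hA hlδ.le,
          ← Real.rpow_mul hl.le, ← Real.rpow_mul hl.le, ← Real.rpow_mul hk.le,
          Real.div_rpow hl.le hk.le]
        have e1 : A ^ w * A ^ (1 - w) = A := by
          rcases hA.eq_or_lt with rfl | hA
          · rw [Real.zero_rpow hw0.ne', zero_mul]
          · rw [← Real.rpow_add hA]; simp
        have e2 : k ^ (δ / r) * k ^ (-δ * w) = (k ^ (δ * (w - 1 / r)))⁻¹ := by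
          rw [← Real.rpow_add hk, ← Real.rpow_neg hk.le]; ring_nf
        have e3 : l ^ (δ / r * (r - 1)) * l ^ (-δ * (1 - w)) = l ^ (δ * (w - 1 / r)) := by
          rw [← Real.rpow_add hl]
          congr 1
          field_simp
          ring
        calc _ = a * b ^ (r - 1) * (A ^ w * A ^ (1 - w)) * (k ^ (δ / r) * k ^ (-δ * w)) *
              (l ^ (δ / r * (r - 1)) * l ^ (-δ * (1 - w))) := by ring
          _ = _ := by rw [e1, e2, e3]; ring

/-- An `L^r(μ)` upper bound for positive sums of powers with lacunary exponents, given moment bounds for the single powers. -/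
theorem lintegral_sum_rpow_le {μ : Measure I} {A δ θ p' r ρ : ℝ} (hA : 0 ≤ A) (hδ : 0 < δ)
    (hθ : 0 < θ) (hθp : θ < p') (hp'r : p' < θ * r) (hr : 1 < r) (hρ : 1 < ρ) {L : ℕ → ℝ}
    (hL : ∀ j, 0 < L j) (hLρ : ∀ j k, j ≤ k → ρ ^ (k - j) * L j ≤ L k)
    (hμ : ∀ j, ∫⁻ t : I, ENNReal.ofReal ((t : ℝ) ^ (p' * L j)) ∂μ ≤
      ENNReal.ofReal (A * L j ^ (-δ))) :
    ∃ C : ℝ, 0 < C ∧ ∀ (J : ℕ) (a : ℕ → ℝ), (∀ j, 0 ≤ a j) →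
      ∫⁻ t : I, ENNReal.ofReal
        ((∑ j ∈ Finset.range J, a j * L j ^ (δ / r) * (t : ℝ) ^ (θ * L j)) ^ r) ∂μ ≤
        ENNReal.ofReal (C * ∑ j ∈ Finset.range J, a j ^ r) := by
  have hp' : 0 < p' := hθ.trans hθp
  have hr0 : 0 < r := by linarith
  have hρ0 : 0 < ρ := by linarith
  set ε := δ * (θ / p' - 1 / r) with hε
  have hε0 : 0 < ε := by
    refine mul_pos hδ (sub_pos.2 ?_)
    rw [div_lt_div_iff₀ hr0 hp']; linarith
  -- The gain between the terms `j` and `k` is `ρ ^ (-ε (k - j)) = ω ^ (-2 (k - j))`. One factor `ω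
  -- ^ (k - j)` compensates the weights of `sum_rpow_le_geometric`; the other makes the double sum
  -- converge.
  set ω := ρ ^ (ε / 2) with hω
  have hω1 : 1 < ω := Real.one_lt_rpow hρ (by positivity)
  have hω0 : 0 < ω := by linarith
  have hωi : ω⁻¹ < 1 := inv_lt_one_of_one_lt₀ hω1
  set M := r * ((1 - ω⁻¹ ^ (r - 1)⁻¹)⁻¹) ^ (r - 1) with hM
  have hM0 : 0 ≤ M := by
    have : ω⁻¹ ^ (r - 1)⁻¹ < 1 := Real.rpow_lt_one (by positivity) hωi
      (inv_pos.2 (by linarith))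
    exact mul_nonneg hr0.le (Real.rpow_nonneg (inv_nonneg.2 (by linarith)) _)
  have hωi' : 0 ≤ (1 - ω⁻¹)⁻¹ := inv_nonneg.2 (by linarith)
  refine ⟨M * A * (4 * (1 - ω⁻¹)⁻¹) + 1, by positivity, fun J a ha => ?_⟩
  set x : ℕ → I → ℝ := fun j t => a j * L j ^ (δ / r) * (t : ℝ) ^ (θ * L j) with hx
  have hx0 : ∀ j t, 0 ≤ x j t := fun j t => mul_nonneg (mul_nonneg (ha j)
    (Real.rpow_nonneg (hL j).le _)) (Real.rpow_nonneg t.2.1 _)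
  have hxm : ∀ j, Measurable (x j) := fun j => by fun_prop
  have hpt : ∀ t, ENNReal.ofReal ((∑ j ∈ Finset.range J, x j t) ^ r) ≤ ENNReal.ofReal M *
      ∑ k ∈ Finset.range J, ∑ j ∈ Finset.range (k + 1),
        ENNReal.ofReal (ω ^ (k - j)) * ENNReal.ofReal (x k t * x j t ^ (r - 1)) := by
    intro t
    have e0 : ∀ k j, 0 ≤ ω ^ (k - j) * (x k t * x j t ^ (r - 1)) := fun k j =>
      mul_nonneg (by positivity) (mul_nonneg (hx0 k t) (Real.rpow_nonneg (hx0 j t) _))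
    have e1 : ∑ k ∈ Finset.range J, ∑ j ∈ Finset.range (k + 1),
        ENNReal.ofReal (ω ^ (k - j)) * ENNReal.ofReal (x k t * x j t ^ (r - 1)) =
        ENNReal.ofReal (∑ k ∈ Finset.range J, ∑ j ∈ Finset.range (k + 1),
          ω ^ (k - j) * (x k t * x j t ^ (r - 1))) := by
      rw [ENNReal.ofReal_sum_of_nonneg fun k _ => Finset.sum_nonneg fun j _ => e0 k j]
      refine Finset.sum_congr rfl fun k _ => ?_
      rw [ENNReal.ofReal_sum_of_nonneg fun j _ => e0 k j]
      refine Finset.sum_congr rfl fun j _ => ?_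
      rw [ENNReal.ofReal_mul (p := ω ^ (k - j)) (by positivity)]
    rw [e1, ← ENNReal.ofReal_mul hM0]
    refine ENNReal.ofReal_le_ofReal ((sum_rpow_le_sum_mul_partial hr.le (hx0 · t) J).trans ?_)
    rw [hM, mul_assoc, Finset.mul_sum (Finset.range J) _ (_ ^ (r - 1))]
    refine mul_le_mul_of_nonneg_left (Finset.sum_le_sum fun k _ => ?_) hr0.le
    refine (mul_le_mul_of_nonneg_left (sum_rpow_le_geometric (sub_pos.2 hr) hω1 (hx0 · t) k)
      (hx0 k t)).trans_eq ?_
    rw [← mul_assoc, mul_comm (x k t), mul_assoc, Finset.mul_sum _ _ (x k t)]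
    congr 1
    exact Finset.sum_congr rfl fun j _ => by ring
  have har : ∀ j, 0 ≤ a j ^ r := fun j => Real.rpow_nonneg (ha j) r
  have hterm : ∀ k j, j ≤ k → ENNReal.ofReal (ω ^ (k - j)) *
      ∫⁻ t, ENNReal.ofReal (x k t * x j t ^ (r - 1)) ∂μ ≤
      ENNReal.ofReal (A * (ω⁻¹ ^ (Nat.dist k j) * (a k ^ r + a j ^ r))) := by
    intro k j hjk
    have e1 := lintegral_mul_mul_rpow_le hA hθ hθp hp'r hr (hL j) (hL k) (hμ j) (hμ k) (ha k) (ha j)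
    refine (mul_le_mul_right e1 _).trans ?_
    rw [← ENNReal.ofReal_mul (by positivity)]
    refine ENNReal.ofReal_le_ofReal ?_
    have e2 : (L j / L k) ^ ε ≤ ω⁻¹ ^ (k - j) * ω⁻¹ ^ (k - j) := by
      have e3 : L j / L k ≤ (ρ ^ (k - j))⁻¹ := by
        rw [div_le_iff₀ (hL k), le_inv_mul_iff₀ (by positivity)]
        exact hLρ j k hjk
      have hLjk : 0 ≤ L j / L k := (div_pos (hL j) (hL k)).le
      refine (Real.rpow_le_rpow hLjk e3 hε0.le).trans_eq ?_
      rw [← mul_pow, ← mul_inv, hω, ← Real.rpow_add hρ0, add_halves,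
        Real.inv_rpow (by positivity), inv_pow, ← Real.rpow_natCast, ← Real.rpow_natCast,
        ← Real.rpow_mul hρ0.le, ← Real.rpow_mul hρ0.le, mul_comm]
    have e4 := mul_rpow_sub_one_le (ha k) (ha j) hr
    have e5 : Nat.dist k j = k - j := by rw [Nat.dist]; omega
    have e6 : 0 ≤ a k * a j ^ (r - 1) := mul_nonneg (ha k) (Real.rpow_nonneg (ha j) _)
    have e7 : ω ^ (k - j) * ω⁻¹ ^ (k - j) = 1 := by
      rw [← mul_pow, mul_inv_cancel₀ hω0.ne', one_pow]
    have e8 : 0 ≤ A * (a k ^ r + a j ^ r) := mul_nonneg hA (add_nonneg (har k) (har j))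
    have e9 : 0 ≤ (L j / L k) ^ ε := Real.rpow_nonneg (div_pos (hL j) (hL k)).le _
    rw [e5, ← hε]
    calc _ ≤ ω ^ (k - j) * (A * (a k ^ r + a j ^ r) * (ω⁻¹ ^ (k - j) * ω⁻¹ ^ (k - j))) := by
          gcongr
      _ = (ω ^ (k - j) * ω⁻¹ ^ (k - j)) * (A * (ω⁻¹ ^ (k - j) * (a k ^ r + a j ^ r))) := by ring
      _ = _ := by rw [e7, one_mul]
  have hmm : ∀ k j, Measurable fun t => ENNReal.ofReal (x k t * x j t ^ (r - 1)) := fun k j =>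
    ((hxm k).mul ((hxm j).pow_const _)).ennreal_ofReal
  have hT0 : ∀ k j, 0 ≤ ω⁻¹ ^ (Nat.dist k j) * (a k ^ r + a j ^ r) := fun k j =>
    mul_nonneg (by positivity) (add_nonneg (har k) (har j))
  calc _ ≤ ∫⁻ t, ENNReal.ofReal M * ∑ k ∈ Finset.range J, ∑ j ∈ Finset.range (k + 1),
        ENNReal.ofReal (ω ^ (k - j)) * ENNReal.ofReal (x k t * x j t ^ (r - 1)) ∂μ :=
        lintegral_mono hpt
    _ = ENNReal.ofReal M * ∑ k ∈ Finset.range J, ∑ j ∈ Finset.range (k + 1),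
        ENNReal.ofReal (ω ^ (k - j)) * ∫⁻ t, ENNReal.ofReal (x k t * x j t ^ (r - 1)) ∂μ := by
        rw [lintegral_const_mul _ (Finset.measurable_sum _ fun k _ =>
          Finset.measurable_sum _ fun j _ => (hmm k j).const_mul _),
          lintegral_finsetSum _ fun k _ => Finset.measurable_sum _ fun j _ => (hmm k j).const_mul _]
        congr 1
        refine Finset.sum_congr rfl fun k _ => ?_
        rw [lintegral_finsetSum _ fun j _ => (hmm k j).const_mul _]
        exact Finset.sum_congr rfl fun j _ => lintegral_const_mul _ (hmm k j)
    _ ≤ ENNReal.ofReal M * ∑ k ∈ Finset.range J, ∑ j ∈ Finset.range J,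
        ENNReal.ofReal (A * (ω⁻¹ ^ (Nat.dist k j) * (a k ^ r + a j ^ r))) := by
        gcongr with k hk
        refine (Finset.sum_le_sum fun j hj => hterm k j
          (Nat.lt_succ_iff.1 (Finset.mem_range.1 hj))).trans ?_
        refine Finset.sum_le_sum_of_subset (Finset.range_subset_range.2 ?_)
        have := Finset.mem_range.1 hk
        omega
    _ = ENNReal.ofReal (M * ∑ k ∈ Finset.range J, ∑ j ∈ Finset.range J,
        A * (ω⁻¹ ^ (Nat.dist k j) * (a k ^ r + a j ^ r))) := by
        rw [ENNReal.ofReal_mul hM0, ENNReal.ofReal_sum_of_nonneg fun k _ =>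
          Finset.sum_nonneg fun j _ => mul_nonneg hA (hT0 k j)]
        congr 1
        refine Finset.sum_congr rfl fun k _ => ?_
        rw [ENNReal.ofReal_sum_of_nonneg fun j _ => mul_nonneg hA (hT0 k j)]
    _ ≤ _ := by
        refine ENNReal.ofReal_le_ofReal ?_
        have e1 : ∑ k ∈ Finset.range J, ∑ j ∈ Finset.range J,
            A * (ω⁻¹ ^ (Nat.dist k j) * (a k ^ r + a j ^ r)) ≤
            A * (4 * (1 - ω⁻¹)⁻¹) * ∑ j ∈ Finset.range J, a j ^ r := by
          have e2 : ∑ k ∈ Finset.range J, ∑ j ∈ Finset.range J,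
              A * (ω⁻¹ ^ (Nat.dist k j) * (a k ^ r + a j ^ r)) =
              2 * A * ∑ j ∈ Finset.range J,
                (∑ k ∈ Finset.range J, ω⁻¹ ^ (Nat.dist k j)) * a j ^ r := by
            simp only [← Finset.mul_sum, mul_add, Finset.sum_add_distrib]
            have e3 : ∑ k ∈ Finset.range J, ∑ j ∈ Finset.range J, ω⁻¹ ^ (Nat.dist k j) * a k ^ r =
                ∑ j ∈ Finset.range J, (∑ k ∈ Finset.range J, ω⁻¹ ^ (Nat.dist k j)) * a j ^ r := by
              refine Finset.sum_congr rfl fun k _ => ?_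
              rw [Finset.sum_mul]
              exact Finset.sum_congr rfl fun j _ => by rw [Nat.dist_comm]
            have e4 : ∑ k ∈ Finset.range J, ∑ j ∈ Finset.range J, ω⁻¹ ^ (Nat.dist k j) * a j ^ r =
                ∑ j ∈ Finset.range J, (∑ k ∈ Finset.range J, ω⁻¹ ^ (Nat.dist k j)) * a j ^ r := by
              rw [Finset.sum_comm]
              exact Finset.sum_congr rfl fun j _ => by rw [Finset.sum_mul]
            rw [e3, e4]
            ring
          rw [e2]
          have e5 : ∑ j ∈ Finset.range J,
              (∑ k ∈ Finset.range J, ω⁻¹ ^ (Nat.dist k j)) * a j ^ r ≤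
              ∑ j ∈ Finset.range J, 2 * (1 - ω⁻¹)⁻¹ * a j ^ r :=
            Finset.sum_le_sum fun j _ => mul_le_mul_of_nonneg_right
              (sum_pow_dist_le (by positivity) hωi _ j) (har j)
          rw [← Finset.mul_sum] at e5
          calc _ ≤ 2 * A * (2 * (1 - ω⁻¹)⁻¹ * ∑ j ∈ Finset.range J, a j ^ r) := by gcongr
            _ = _ := by ring
        have e6 : 0 ≤ ∑ j ∈ Finset.range J, a j ^ r := Finset.sum_nonneg fun j _ => har j
        have e7 := mul_le_mul_of_nonneg_left e1 hM0
        linarith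

/-! ### Moments of `μ` and norms of monomials. -/

/-- Weak type bounds for `t ^ l` give bounds for its moments of higher order. -/
lemma lintegral_rpow_le_of_weak {μ : Measure I} {p p' l G : ℝ} (hp : 0 < p) (hp' : p < p')
    (hl : 0 < l) (hG : 0 ≤ G)
    (h : ∀ y : ℝ, 0 < y → μ {t : I | y < (t : ℝ) ^ l} ≤ ENNReal.ofReal (G * y ^ (-p))) :
    ∫⁻ t : I, ENNReal.ofReal ((t : ℝ) ^ (p' * l)) ∂μ ≤ ENNReal.ofReal (p' / (p' - p) * G) := by
  have hpp : 0 < p' - p := by linarith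
  have h1 := lintegral_rpow_eq_lintegral_meas_lt_mul μ (f := fun t : I => (t : ℝ) ^ l)
    (Eventually.of_forall fun t => Real.rpow_nonneg t.2.1 l) (by fun_prop) (hp.trans hp')
  have h2 : ∀ t : I, ENNReal.ofReal ((t : ℝ) ^ (p' * l)) = ENNReal.ofReal (((t : ℝ) ^ l) ^ p') := by
    intro t
    rw [← Real.rpow_mul t.2.1, mul_comm]
  rw [lintegral_congr h2, h1]
  -- In the layer cake formula only `y < 1` matters because `t ^ l ≤ 1`; near `0` the integrand `y ^
  -- (p' - p - 1)` is integrable because `p' > p`.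
  have h3 : ∀ y ∈ Set.Ioi (0 : ℝ), μ {t : I | y < (t : ℝ) ^ l} * ENNReal.ofReal (y ^ (p' - 1)) ≤
      (Set.Ioc (0 : ℝ) 1).indicator (fun y => ENNReal.ofReal (G * y ^ (p' - p - 1))) y := by
    intro y hy
    have hy0 : 0 < y := hy
    by_cases hy1 : y ≤ 1
    · rw [Set.indicator_of_mem (show y ∈ Set.Ioc (0 : ℝ) 1 from ⟨hy0, hy1⟩)]
      refine (mul_le_mul_left (h y hy0) _).trans_eq ?_
      rw [← ENNReal.ofReal_mul (by positivity), mul_assoc, ← Real.rpow_add hy0]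
      ring_nf
    · have : {t : I | y < (t : ℝ) ^ l} = ∅ := by
        refine Set.eq_empty_of_forall_notMem fun t ht => hy1 ?_
        exact (le_of_lt ht).trans (Real.rpow_le_one t.2.1 t.2.2 hl.le)
      rw [this, measure_empty, zero_mul]
      exact zero_le
  have hint : IntervalIntegrable (fun y : ℝ => y ^ (p' - p - 1)) volume 0 1 :=
    intervalIntegral.intervalIntegrable_rpow' (by linarith)
  calc _ ≤ ENNReal.ofReal p' * ∫⁻ y in Set.Ioi (0 : ℝ),
        (Set.Ioc (0 : ℝ) 1).indicator (fun y => ENNReal.ofReal (G * y ^ (p' - p - 1))) y :=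
        mul_le_mul_right (setLIntegral_mono' measurableSet_Ioi h3) _
    _ ≤ ENNReal.ofReal p' * ∫⁻ y in Set.Ioc (0 : ℝ) 1, ENNReal.ofReal (G * y ^ (p' - p - 1)) := by
        refine mul_le_mul_right ((setLIntegral_le_lintegral _ _).trans_eq ?_) _
        rw [lintegral_indicator measurableSet_Ioc]
    _ = ENNReal.ofReal p' * ENNReal.ofReal (G * (1 / (p' - p))) := by
        congr 1
        rw [← ofReal_integral_eq_lintegral_ofReal, integral_const_mul,
          ← intervalIntegral.integral_of_le zero_le_one, integral_rpow (Or.inl (by linarith))]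
        · rw [sub_add_cancel, Real.one_rpow, Real.zero_rpow hpp.ne', sub_zero]
        · exact (hint.1).const_mul G
        · refine (ae_restrict_iff' measurableSet_Ioc).2 (Eventually.of_forall fun y hy => ?_)
          exact mul_nonneg hG (Real.rpow_nonneg hy.1.le _)
    _ = _ := by
        rw [← ENNReal.ofReal_mul (by linarith)]
        congr 1
        ring

/-- Since `t ≤ e ^ (-(1 - t))`, the integral is dominated by a Gamma integral in `x = 1 - t`. -/
lemma lintegral_muntzMonomial_le (𝕜 : Type*) [RCLike 𝕜] {α s l : ℝ} (hα : 0 < α) (hs : 0 < s)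
    (hl : 0 < l) : ∫⁻ t, ‖muntzMonomial 𝕜 l t‖ₑ ^ s ∂muntzWeight α ≤
      ENNReal.ofReal (Real.Gamma α * (l * s) ^ (-α)) := by
  have hls : 0 < l * s := by positivity
  set g : ℝ → ℝ := fun x => x ^ (α - 1) * Real.exp (-(l * s * x)) with hg
  have hmeas : Measurable fun t : I => ‖muntzMonomial 𝕜 l t‖ₑ ^ s := by
    have : Measurable fun t : I => muntzMonomial 𝕜 l t := by
      unfold muntzMonomial
      exact RCLike.measurable_ofReal.comp (by fun_prop)
    exact this.enorm.pow_const s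
  have hint : IntegrableOn g (Set.Ioi 0) := by
    have := integrableOn_rpow_mul_exp_neg_mul_rpow (p := 1) (s := α - 1) (b := l * s)
      (by linarith) one_pos hls
    simpa only [Real.rpow_one, neg_mul] using this
  have h1 : ∀ t : I, ((fun x : I => ENNReal.ofReal ((1 - (x : ℝ)) ^ (α - 1))) *
      fun t : I => ‖muntzMonomial 𝕜 l t‖ₑ ^ s) t ≤ ENNReal.ofReal (g (1 - t)) := by
    intro t
    have ht0 : 0 ≤ (t : ℝ) := t.2.1
    have ht1 : 0 ≤ 1 - (t : ℝ) := by linarith [t.2.2]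
    rw [Pi.mul_apply, muntzMonomial, ← ofReal_norm, RCLike.norm_ofReal,
      abs_of_nonneg (Real.rpow_nonneg ht0 _),
      ENNReal.ofReal_rpow_of_nonneg (Real.rpow_nonneg ht0 _) hs.le,
      ← ENNReal.ofReal_mul (Real.rpow_nonneg ht1 _), ← Real.rpow_mul ht0]
    refine ENNReal.ofReal_le_ofReal (mul_le_mul_of_nonneg_left ?_ (Real.rpow_nonneg ht1 _))
    have e1 : (t : ℝ) ≤ Real.exp (-(1 - t)) := by
      have := Real.one_sub_le_exp_neg (1 - (t : ℝ)); linarith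
    refine (Real.rpow_le_rpow ht0 e1 hls.le).trans_eq ?_
    rw [← Real.exp_mul]; ring_nf
  rw [muntzWeight, lintegral_withDensity_eq_lintegral_mul _ (measurable_muntzWeight_density α) hmeas]
  calc _ ≤ ∫⁻ t : I, ENNReal.ofReal (g (1 - t)) := lintegral_mono h1
    _ = ∫⁻ t in Set.Icc (0 : ℝ) 1, ENNReal.ofReal (g (1 - t)) :=
        lintegral_unitInterval fun t => ENNReal.ofReal (g (1 - t))
    _ = ∫⁻ t in Set.Ico (0 : ℝ) 1, ENNReal.ofReal (g (1 - t)) := by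
        rw [Measure.restrict_congr_set Ico_ae_eq_Icc]
    _ = ∫⁻ t : ℝ, (Set.Ioc (0 : ℝ) 1).indicator (fun x => ENNReal.ofReal (g x)) (1 - t) := by
        rw [← lintegral_indicator measurableSet_Ico]
        refine lintegral_congr fun t => ?_
        by_cases ht : t ∈ Set.Ico (0 : ℝ) 1
        · rw [Set.indicator_of_mem ht, Set.indicator_of_mem]
          exact ⟨by linarith [ht.2], by linarith [ht.1]⟩
        · rw [Set.indicator_of_notMem ht, Set.indicator_of_notMem]
          exact fun h => ht ⟨by linarith [h.2], by linarith [h.1]⟩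
    _ = ∫⁻ x in Set.Ioc (0 : ℝ) 1, ENNReal.ofReal (g x) := by
        rw [lintegral_sub_left_eq_self, lintegral_indicator measurableSet_Ioc]
    _ ≤ ∫⁻ x in Set.Ioi (0 : ℝ), ENNReal.ofReal (g x) :=
        lintegral_mono_set fun x hx => hx.1
    _ = ENNReal.ofReal (∫ x in Set.Ioi (0 : ℝ), g x) := by
        rw [ofReal_integral_eq_lintegral_ofReal hint]
        refine (ae_restrict_iff' measurableSet_Ioi).2 (Eventually.of_forall fun x hx => ?_)
        exact mul_nonneg (Real.rpow_nonneg (le_of_lt hx) _) (Real.exp_pos _).le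
    _ = _ := by
        rw [hg, Real.integral_rpow_mul_exp_neg_mul_Ioi hα hls, one_div, Real.inv_rpow hls.le,
          Real.rpow_neg hls.le, mul_comm]

/-! ### Regrouping a quasi-lacunary sequence into separated clusters. -/

lemma exists_mem_block {n : ℕ → ℕ} (hn : StrictMono n) (h0 : n 0 = 0) (i : ℕ) :
    ∃ k, n k ≤ i ∧ i < n (k + 1) := by
  have hex : ∃ m, i < n m := ⟨i + 1, (Nat.lt_succ_self i).trans_le (hn.id_le (i + 1))⟩
  obtain ⟨k, hk⟩ : ∃ k, Nat.find hex = k + 1 := by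
    refine Nat.exists_eq_succ_of_ne_zero fun h => ?_
    have := Nat.find_spec hex
    rw [h, h0] at this
    omega
  refine ⟨k, not_lt.1 (Nat.find_min hex (by omega)), ?_⟩
  have := Nat.find_spec hex
  rwa [hk] at this

namespace IsQuasiLacunary

variable {Λ : ℕ → ℝ} {n : ℕ → ℕ}

/-- The ratio condition compares only block maxima, so neighbouring blocks need not be separated.
Advancing by two block lengths passes from `Λ i` beyond the maximum of the next block. -/
lemma exists_mul_le_add (h : IsQuasiLacunary Λ n) :
    ∃ (D : ℕ) (q : ℝ), 1 ≤ D ∧ 1 < q ∧ ∀ i, q * Λ i ≤ Λ (i + D) := by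
  obtain ⟨N, hN1, hN⟩ := h.card_le
  obtain ⟨q, hq, hr⟩ := h.ratio
  obtain ⟨k₀, hk₀⟩ := eventually_atTop.1 hr
  have hlen : ∀ k, n (k + 1) ≤ n k + N := by
    intro k
    have := hN k
    rw [muntzBlock, Finset.card_image_of_injective _ h.strictMono.injective, Nat.card_Ico] at this
    omega
  have hmain : ∀ i, n k₀ ≤ i → q * Λ i ≤ Λ (i + 2 * N) := by
    intro i hi
    obtain ⟨k, hk, hk'⟩ := exists_mem_block h.blocks_strictMono h.blocks_zero i
    have hkk : k₀ < k + 1 := h.blocks_strictMono.lt_iff_lt.1 (hi.trans_lt hk')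
    have h1 := hk₀ (k + 1) (by omega)
    rw [lt_div_iff₀ (h.pos _)] at h1
    have h2 : Λ i ≤ Λ (n (k + 1) - 1) := h.strictMono.monotone (by omega)
    have h3 : Λ (n (k + 1 + 1) - 1) ≤ Λ (i + 2 * N) := h.strictMono.monotone (by
      have := hlen k
      have := hlen (k + 1)
      omega)
    have h4 : q * Λ i ≤ q * Λ (n (k + 1) - 1) := by gcongr
    linarith
  -- The extra `n k₀` jumps over the initial blocks, for which no ratio is assumed.
  refine ⟨n k₀ + 2 * N, q, by omega, hq, fun i => ?_⟩
  have h1 := hmain (i + n k₀) (by omega)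
  have h2 : q * Λ i ≤ q * Λ (i + n k₀) := by
    have := h.strictMono.monotone (Nat.le_add_right i (n k₀))
    gcongr
  rw [← add_assoc]
  exact h2.trans h1

/-- The exponents split into successive clusters of bounded ratio, separated by a fixed ratio. -/
theorem exists_clusterSystem (h : IsQuasiLacunary Λ n) :
    ∃ (D : ℕ) (Q κ : ℝ) (s : ℕ → ℕ), 1 ≤ Q ∧ 1 < κ ∧ s 0 = 0 ∧ StrictMono s ∧
      IsClusterSystem D Q (κ ^ 3) (fun j => (Finset.Ico (s j) (s (j + 1))).image Λ)
        (fun j => Λ (s j)) (fun j => Λ (s (j + 1) - 1)) := by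
  obtain ⟨D, q, hD, hq, hΛ⟩ := h.exists_mul_le_add
  have hD0 : (0 : ℝ) < D := by exact_mod_cast hD
  -- Chosen so that `(κ ^ 3) ^ D = q`: among any `D` successive ratios of exponents one is at least
  -- `κ ^ 3`, which supplies a place to cut.
  set κ := q ^ (1 / (3 * D) : ℝ) with hκ
  have hκ1 : 1 < κ := Real.one_lt_rpow hq (by positivity)
  set ρ := κ ^ 3 with hρ
  have hρ1 : 1 < ρ := one_lt_pow₀ hκ1 (by norm_num)
  have hρ0 : 0 < ρ := by linarith
  have hρD : ρ ^ D = q := by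
    rw [hρ, hκ, ← pow_mul, ← Real.rpow_natCast, ← Real.rpow_mul (by linarith)]
    push_cast
    rw [one_div_mul_cancel (by positivity), Real.rpow_one]
  have hstep : ∀ i e, (∀ m, i ≤ m → m < i + e → Λ (m + 1) < ρ * Λ m) → Λ (i + e) ≤ ρ ^ e * Λ i := by
    intro i e
    induction e with
    | zero => intro _; simp
    | succ e ih =>
      intro hm
      have h1 := ih fun m h1 h2 => hm m h1 (by omega)
      have h2 := hm (i + e) (by omega) (by omega)
      rw [← add_assoc, pow_succ', mul_assoc]
      exact h2.le.trans (by gcongr)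
  have hex : ∀ i, ∃ m, i ≤ m ∧ m < i + D ∧ ρ * Λ m ≤ Λ (m + 1) := by
    intro i
    by_contra hcon
    push Not at hcon
    obtain ⟨e, rfl⟩ : ∃ e, D = e + 1 := ⟨D - 1, by omega⟩
    have h1 := hstep i e fun m h1 h2 => hcon m h1 (by omega)
    have h2 := hcon (i + e) (by omega) (by omega)
    have h3 := hΛ i
    rw [← hρD, pow_succ', mul_assoc] at h3
    have h4 : ρ * Λ (i + e) ≤ ρ * (ρ ^ e * Λ i) := by gcongr
    rw [← add_assoc] at h3
    linarith
  classical
  -- Cutting at the first large gap keeps the fewer than `D` ratios inside a cluster below `ρ`, so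
  -- `Q = q` works.
  set next : ℕ → ℕ := fun i => Nat.find (hex i) with hnext
  set s : ℕ → ℕ := fun j => Nat.rec 0 (fun _ i => next i + 1) j with hs
  have hs1 : ∀ j, s (j + 1) = next (s j) + 1 := fun j => rfl
  have hspec : ∀ j, s j ≤ next (s j) ∧ next (s j) < s j + D ∧
      ρ * Λ (next (s j)) ≤ Λ (next (s j) + 1) := fun j => Nat.find_spec (hex (s j))
  refine ⟨D, q, κ, s, hq.le, hκ1, rfl, strictMono_nat_of_lt_succ fun j => ?_, ?_⟩
  · rw [hs1]; have := (hspec j).1; omega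
  · have hsub : ∀ j, s (j + 1) - 1 = next (s j) := fun j => by rw [hs1]; rfl
    refine ⟨fun j => h.pos _, fun j z hz => ?_, fun j => ?_, fun j => ?_, fun j => ?_, fun j => ?_⟩
    · obtain ⟨i, hi, rfl⟩ := Finset.mem_image.1 hz
      have hi' := Finset.mem_Ico.1 hi
      exact ⟨h.strictMono.monotone hi'.1, h.strictMono.monotone (by omega)⟩
    · rw [hsub]
      exact h.strictMono.monotone (hspec j).1
    · rw [hsub]
      obtain ⟨h1, h2, -⟩ := hspec j
      obtain ⟨e, he⟩ := Nat.exists_eq_add_of_le h1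
      have h3 := hstep (s j) e fun m hm1 hm2 => by
        by_contra hcon
        exact Nat.find_min (hex (s j)) (m := m) (by rw [← he] at hm2; exact hm2)
          ⟨hm1, by omega, not_lt.1 hcon⟩
      rw [he]
      refine h3.trans ?_
      rw [← hρD]
      have := h.pos (s j)
      gcongr
      · exact hρ1.le
      · omega
    · have := (hspec j).2.2
      rw [hsub, hs1]
      exact this
    · refine Finset.card_image_le.trans ?_
      rw [Nat.card_Ico, hs1]
      have := (hspec j).2.1
      omega

end IsQuasiLacunary

/-! ### Assembling the two bounds. -/

lemma biUnion_image_Ico {Λ : ℕ → ℝ} {s : ℕ → ℕ} (hs0 : s 0 = 0) (hs : StrictMono s) (J : ℕ) :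
    (Finset.range J).biUnion (fun j => (Finset.Ico (s j) (s (j + 1))).image Λ) =
      (Finset.range (s J)).image Λ := by
  ext z
  simp only [Finset.mem_biUnion, Finset.mem_image, Finset.mem_range, Finset.mem_Ico]
  constructor
  · rintro ⟨j, hj, i, ⟨-, hi⟩, rfl⟩
    exact ⟨i, hi.trans_le (hs.monotone hj), rfl⟩
  · rintro ⟨i, hi, rfl⟩
    obtain ⟨k, hk, hk'⟩ := exists_mem_block hs hs0 i
    exact ⟨k, hs.lt_iff_lt.1 (hk.trans_lt hi), i, ⟨hk, hk'⟩, rfl⟩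

lemma exists_expSum_of_mem_muntzSpace {𝕜 : Type*} [RCLike 𝕜] {Λ : ℕ → ℝ} {s : ℕ → ℕ}
    (hΛ : Function.Injective Λ) (hpos : ∀ i, 0 < Λ i) (hs0 : s 0 = 0) (hs : StrictMono s)
    {f : I → 𝕜} (hf : f ∈ muntzSpace 𝕜 Λ) :
    ∃ (J : ℕ) (c : ℝ → 𝕜), Measurable f ∧ f 0 = 0 ∧ ∀ t : I, 0 < (t : ℝ) → f t = expSum
      ((Finset.range J).biUnion fun j => (Finset.Ico (s j) (s (j + 1))).image Λ) c
        (-Real.log t) := by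
  obtain ⟨d, hd⟩ := Finsupp.mem_span_range_iff_exists_finsupp.1 hf
  set J := d.support.sup id + 1 with hJ
  have hsub : d.support ⊆ Finset.range (s J) := by
    intro i hi
    have h1 : i ≤ d.support.sup id := Finset.le_sup (f := id) hi
    have h2 : J ≤ s J := hs.id_le J
    exact Finset.mem_range.2 (by omega)
  have hft : f = fun t => ∑ i ∈ Finset.range (s J), d i * muntzMonomial 𝕜 (Λ i) t := by
    rw [← hd, Finsupp.sum_of_support_subset d hsub (fun i a => a • muntzMonomial 𝕜 (Λ i))
      fun i _ => zero_smul _ _]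
    funext t
    simp only [Finset.sum_apply, Pi.smul_apply, smul_eq_mul]
  refine ⟨J, fun z => d (Function.invFun Λ z), ?_, ?_, fun t ht => ?_⟩
  · rw [hft]
    refine Finset.measurable_sum _ fun i _ => Measurable.const_mul ?_ _
    unfold muntzMonomial
    exact RCLike.measurable_ofReal.comp (by fun_prop)
  · rw [hft]
    refine Finset.sum_eq_zero fun i _ => ?_
    rw [muntzMonomial, Set.Icc.coe_zero, Real.zero_rpow (hpos i).ne', RCLike.ofReal_zero, mul_zero]
  · rw [biUnion_image_Ico hs0 hs, hft, expSum, Finset.sum_image hΛ.injOn]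
    refine Finset.sum_congr rfl fun i _ => ?_
    rw [Function.leftInverse_invFun hΛ i, muntzMonomial, Real.rpow_def_of_pos ht, mul_comm]
    ring_nf

lemma sum_rpow_le_rpow_sum {r s : ℝ} (hs : 0 < s) (hsr : s ≤ r) (J : ℕ) {a : ℕ → ℝ}
    (ha : ∀ j, 0 ≤ a j) :
    ∑ j ∈ Finset.range J, a j ^ r ≤ (∑ j ∈ Finset.range J, a j ^ s) ^ (r / s) := by
  have has : ∀ j, 0 ≤ a j ^ s := fun j => Real.rpow_nonneg (ha j) s
  set Z := ∑ j ∈ Finset.range J, a j ^ s with hZ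
  have hZ0 : 0 ≤ Z := Finset.sum_nonneg fun j _ => has j
  have hrs : 0 ≤ r / s - 1 := by rw [sub_nonneg, one_le_div hs]; exact hsr
  have key : ∀ x : ℝ, 0 ≤ x → x ^ (r / s) = x * x ^ (r / s - 1) := by
    intro x hx
    rcases hx.eq_or_lt with rfl | hx
    · rw [Real.zero_rpow (by have : 0 < r / s := by linarith
                             exact this.ne'), zero_mul]
    · nth_rewrite 2 [← Real.rpow_one x]
      rw [← Real.rpow_add hx]; ring_nf
  rw [key Z hZ0, hZ, Finset.sum_mul, ← hZ]
  refine Finset.sum_le_sum fun j hj => ?_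
  have h1 : a j ^ s ≤ Z := Finset.single_le_sum (fun j _ => has j) hj
  have h2 : a j ^ r = (a j ^ s) ^ (r / s) := by
    rw [← Real.rpow_mul (ha j)]; congr 1; field_simp
  rw [h2, key _ (has j)]
  exact mul_le_mul_of_nonneg_left (Real.rpow_le_rpow (has j) h1 hrs) (has j)

/-- The only use of the weak type hypothesis, and only for monomials. The `p`-th power of the
`L^(p/β)` norm of `t ^ λ` is the `β`-th power of an integral of size `λ ^ (-α)`; hence the exponent
`α β`. -/
lemma IsRestrictedWeakType.lintegral_rpow_le {𝕜 : Type*} [RCLike 𝕜] {α β p p' : ℝ} (hα : 0 < α)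
    (hβ : 1 ≤ β) (hp : β ≤ p) (hp' : p < p') {Λ : ℕ → ℝ} {n : ℕ → ℕ} (hΛ : IsQuasiLacunary Λ n)
    {μ : Measure I} (h : IsRestrictedWeakType n α β μ p (muntzInclusion 𝕜 Λ)) :
    ∃ A : ℝ, 0 ≤ A ∧ ∀ i, ∫⁻ t : I, ENNReal.ofReal ((t : ℝ) ^ (p' * Λ i)) ∂μ ≤
      ENNReal.ofReal (A * Λ i ^ (-(α * β))) := by
  obtain ⟨C, hC, h⟩ := h
  have hp0 : 0 < p := by linarith
  have hβ0 : 0 < β := by linarith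
  have hpβ : 0 < p / β := by positivity
  have hΓ := Real.Gamma_pos_of_pos hα
  set G := Real.Gamma α ^ β * (p / β) ^ (-(α * β)) with hG
  have hG0 : 0 ≤ G := by positivity
  have hCp : 0 < C ^ p := Real.rpow_pos_of_pos hC p
  refine ⟨p' / (p' - p) * (C ^ p * G), mul_nonneg (div_nonneg (by linarith) (by linarith))
    (by positivity), fun i => ?_⟩
  obtain ⟨k, hk, hk'⟩ := exists_mem_block hΛ.blocks_strictMono hΛ.blocks_zero i
  have hl := hΛ.pos i
  have hlδ := Real.rpow_pos_of_pos hl (-(α * β))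
  set f : muntzSpace 𝕜 Λ := ⟨muntzMonomial 𝕜 (Λ i), Submodule.subset_span ⟨i, rfl⟩⟩ with hf
  have hfblock : (f : I → 𝕜) ∈ muntzBlockSpace 𝕜 Λ n k :=
    Submodule.subset_span ⟨Λ i, Finset.mem_coe.2 (Finset.mem_image_of_mem _
      (Finset.mem_Ico.2 ⟨hk, hk'⟩)), rfl⟩
  have hnorm : eLpNorm (f : I → 𝕜) (ENNReal.ofReal (p / β)) (muntzWeight α) ^ p ≤
      ENNReal.ofReal (G * Λ i ^ (-(α * β))) := by
    rw [eLpNorm_eq_lintegral_rpow_enorm_toReal (by simpa using hpβ) ENNReal.ofReal_ne_top,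
      ENNReal.toReal_ofReal hpβ.le, ← ENNReal.rpow_mul]
    have e1 : 1 / (p / β) * p = β := by field_simp
    rw [e1]
    refine (ENNReal.rpow_le_rpow (lintegral_muntzMonomial_le 𝕜 hα hpβ hl) hβ0.le).trans_eq ?_
    have e2 : 0 ≤ (Λ i * (p / β)) ^ (-α) := by positivity
    rw [ENNReal.ofReal_rpow_of_nonneg (by positivity) hβ0.le, Real.mul_rpow hΓ.le e2,
      ← Real.rpow_mul (by positivity), Real.mul_rpow hl.le hpβ.le, hG, neg_mul]
    congr 1
    ring
  have := lintegral_rpow_le_of_weak (μ := μ) hp0 hp' hl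
    (G := C ^ p * (G * Λ i ^ (-(α * β)))) (by positivity) fun y hy => by
      have h1 := h k f hfblock y hy
      have h2 : {t : I | y < ‖muntzInclusion 𝕜 Λ f t‖} = {t : I | y < (t : ℝ) ^ Λ i} := by
        ext t
        have : ‖muntzInclusion 𝕜 Λ f t‖ = (t : ℝ) ^ Λ i := by
          change ‖muntzMonomial 𝕜 (Λ i) t‖ = _
          rw [muntzMonomial, RCLike.norm_ofReal, abs_of_nonneg (Real.rpow_nonneg t.2.1 _)]
        simp only [Set.mem_ofPred_eq, this]
      rw [h2] at h1
      refine h1.trans ((mul_le_mul_right hnorm _).trans_eq ?_)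
      have hy' := Real.rpow_pos_of_pos hy (-p)
      rw [← ENNReal.ofReal_mul (by positivity)]
      congr 1
      ring
  refine this.trans_eq ?_
  congr 1
  ring

theorem mainTheorem7 (𝕜 : Type*) [RCLike 𝕜] (α β p : ℝ) (hα : 0 < α) (hβ : 1 ≤ β) (hp : β ≤ p)
    (Λ : ℕ → ℝ) (n : ℕ → ℕ) (hΛ : IsQuasiLacunary Λ n) (μ : Measure I)
    (h : IsRestrictedWeakType n α β μ p (muntzInclusion 𝕜 Λ)) :
    ∀ r : ℝ, p < r → IsStrongType α β μ r (muntzInclusion 𝕜 Λ) := by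
  intro r hpr
  have hβ0 : 0 < β := by linarith
  have hr0 : 0 < r := by linarith
  set s := r / β with hs
  have hs1 : 1 ≤ s := by rw [hs, one_le_div hβ0]; linarith
  have hs0 : 0 < s := by linarith
  have hsr : s ≤ r := div_le_self hr0.le hβ
  have hrs : r / s = β := by rw [hs]; field_simp
  have hαs : α * β / r = α / s := by rw [hs]; field_simp
  -- With `p' = (2 p + r) / 3`, the numbers `p < p' < θ r < r` are equally spaced. Moreover `θ < 1 ≤
  -- p < p'`, as the Hölder step requires.
  set θ := (p + 2 * r) / (3 * r) with hθ
  have hθ0 : 0 < θ := by have : 0 < p + 2 * r := by linarith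
                         positivity
  have hθ1 : θ < 1 := by rw [hθ, div_lt_one (by positivity)]; linarith
  have hθr : θ * r = (p + 2 * r) / 3 := by rw [hθ]; field_simp
  obtain ⟨D, Q, κ, σ', hQ, hκ, hσ0, hσ, hsys⟩ := hΛ.exists_clusterSystem
  set S : ℕ → Finset ℝ := fun j => (Finset.Ico (σ' j) (σ' (j + 1))).image Λ with hS
  set L : ℕ → ℝ := fun j => Λ (σ' j) with hL
  have hρ : 1 < κ ^ 3 := one_lt_pow₀ hκ (by norm_num)
  obtain ⟨A, hA, hmom⟩ := h.lintegral_rpow_le hα hβ hp (p' := (2 * p + r) / 3) (by linarith) hΛ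
  obtain ⟨C₁, hC₁, hup⟩ := lintegral_sum_rpow_le (μ := μ) (δ := α * β) (θ := θ) (r := r)
    (ρ := κ ^ 3) (L := L) hA (by positivity) hθ0 (by linarith) (by rw [hθr]; linarith)
    (by linarith) hρ hsys.pos (fun j k hjk => hsys.pow_mul_L_le hρ hjk) fun j => hmom (σ' j)
  obtain ⟨C₂, hC₂, hlow⟩ := hsys.sum_expSup_rpow_le 𝕜 hQ hκ hα hs1
  obtain ⟨Cd, hCd, hdecay⟩ := expSum_decay 𝕜 hθ0 hθ1 D
  have hCd0 : 0 < Cd := by linarith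
  have hCdr : 0 < Cd ^ r := Real.rpow_pos_of_pos hCd0 r
  refine ⟨(C₁ * Cd ^ r) ^ (1 / r) * C₂ ^ (1 / s), mul_pos (Real.rpow_pos_of_pos (by positivity) _)
    (Real.rpow_pos_of_pos hC₂ _), fun f => ?_⟩
  obtain ⟨J, c, hfm, hf0, hfc⟩ := exists_expSum_of_mem_muntzSpace hΛ.strictMono.injective hΛ.pos
    hσ0 hσ f.2
  change eLpNorm (f : I → 𝕜) (ENNReal.ofReal r) μ ≤ _
  set g : I → 𝕜 := (f : I → 𝕜) with hg
  set a : ℕ → ℝ := fun j => expSup (S j) c * L j ^ (-(α / s)) with ha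
  have ha0 : ∀ j, 0 ≤ a j := fun j =>
    mul_nonneg (expSup_nonneg _ _) (Real.rpow_nonneg (hsys.pos j).le _)
  have hterm : ∀ (j : ℕ) (t : I), 0 ≤ Cd * a j * L j ^ (α * β / r) * (t : ℝ) ^ (θ * L j) :=
    fun j t => mul_nonneg (mul_nonneg (mul_nonneg hCd0.le (ha0 j))
      (Real.rpow_nonneg (hsys.pos j).le _)) (Real.rpow_nonneg t.2.1 _)
  have hpt : ∀ t : I, ‖g t‖ ≤
      ∑ j ∈ Finset.range J, Cd * a j * L j ^ (α * β / r) * (t : ℝ) ^ (θ * L j) := by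
    intro t
    -- The substitution `y = -log t` excludes `t = 0`, where `μ` may have mass; there `f` vanishes
    -- because all exponents are positive.
    rcases t.2.1.eq_or_lt with ht | ht
    · have : t = 0 := Subtype.ext ht.symm
      rw [this, hf0, norm_zero]
      exact Finset.sum_nonneg fun j _ => hterm j 0
    · rw [hfc t ht, hsys.expSum_biUnion hρ]
      refine (norm_sum_le _ _).trans (Finset.sum_le_sum fun j _ => ?_)
      have hy : 0 ≤ -Real.log t := neg_nonneg.2 (Real.log_nonpos t.2.1 t.2.2)
      have hLj := hsys.pos j
      refine (hdecay (S j) c (L j) (expSup (S j) c) (hsys.card_le j) hLj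
        (fun z hz => (hsys.mem j z hz).1)
        (fun y hy => norm_expSum_le_expSup hsys.exponent_pos c hy) _ hy).trans_eq ?_
      have e1 : L j ^ (-(α / s)) * L j ^ (α * β / r) = 1 := by
        rw [← Real.rpow_add hLj, hαs]; simp
      have e2 : Real.exp (-(θ * L j) * -Real.log t) = (t : ℝ) ^ (θ * L j) := by
        rw [Real.rpow_def_of_pos ht]; ring_nf
      rw [e2, ha]
      calc _ = Cd * expSup (S j) c * 1 * (t : ℝ) ^ (θ * L j) := by ring
        _ = _ := by rw [← e1]; ring
  have h1 : ∫⁻ t, ‖g t‖ₑ ^ r ∂μ ≤ ENNReal.ofReal (C₁ * Cd ^ r) *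
      (ENNReal.ofReal C₂ * ∫⁻ t, ‖g t‖ₑ ^ s ∂muntzWeight α) ^ β := by
    have has : 0 ≤ ∑ j ∈ Finset.range J, a j ^ s :=
      Finset.sum_nonneg fun j _ => Real.rpow_nonneg (ha0 j) s
    calc _ ≤ ∫⁻ t : I, ENNReal.ofReal ((∑ j ∈ Finset.range J,
          Cd * a j * L j ^ (α * β / r) * (t : ℝ) ^ (θ * L j)) ^ r) ∂μ := by
          refine lintegral_mono fun t => ?_
          rw [← ofReal_norm, ENNReal.ofReal_rpow_of_nonneg (norm_nonneg _) hr0.le]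
          exact ENNReal.ofReal_le_ofReal (Real.rpow_le_rpow (norm_nonneg _) (hpt t) hr0.le)
      _ ≤ ENNReal.ofReal (C₁ * ∑ j ∈ Finset.range J, (Cd * a j) ^ r) :=
          hup J _ fun j => mul_nonneg hCd0.le (ha0 j)
      _ = ENNReal.ofReal (C₁ * Cd ^ r * ∑ j ∈ Finset.range J, a j ^ r) := by
          congr 1
          rw [mul_assoc, Finset.mul_sum _ _ (Cd ^ r)]
          congr 1
          exact Finset.sum_congr rfl fun j _ => Real.mul_rpow hCd0.le (ha0 j)
      _ ≤ ENNReal.ofReal (C₁ * Cd ^ r * (∑ j ∈ Finset.range J, a j ^ s) ^ β) := by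
          refine ENNReal.ofReal_le_ofReal ?_
          -- The embedding of `ℓ^s` into `ℓ^r` requires `s = r / β ≤ r`, which is where `β ≥ 1`
          -- enters.
          rw [← hrs]
          gcongr
          exact sum_rpow_le_rpow_sum hs0 hsr J ha0
      _ = ENNReal.ofReal (C₁ * Cd ^ r) * ENNReal.ofReal (∑ j ∈ Finset.range J, a j ^ s) ^ β := by
          rw [ENNReal.ofReal_mul (by positivity), ENNReal.ofReal_rpow_of_nonneg has hβ0.le]
      _ ≤ _ := by
          gcongr
          exact hlow J c g hfm hfc
  rw [eLpNorm_eq_lintegral_rpow_enorm_toReal (by simpa using hr0) ENNReal.ofReal_ne_top,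
    eLpNorm_eq_lintegral_rpow_enorm_toReal (by simpa using hs0) ENNReal.ofReal_ne_top,
    ENNReal.toReal_ofReal hr0.le, ENNReal.toReal_ofReal hs0.le]
  have hr' : 0 ≤ 1 / r := by positivity
  have hs' : 0 ≤ 1 / s := by positivity
  refine (ENNReal.rpow_le_rpow h1 hr').trans_eq ?_
  have e1 : β * (1 / r) = 1 / s := by rw [hs]; field_simp
  rw [ENNReal.mul_rpow_of_nonneg _ _ hr', ← ENNReal.rpow_mul, e1,
    ENNReal.mul_rpow_of_nonneg _ _ hs', ENNReal.ofReal_rpow_of_nonneg (by positivity) hr',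
    ENNReal.ofReal_rpow_of_nonneg hC₂.le hs', ← mul_assoc,
    ← ENNReal.ofReal_mul (Real.rpow_nonneg (by positivity) _)]
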